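/- A metric space $T$ is called an $\mathbb R$-tree if any two of its points are joined by a unique geodesic segment (isometric image of a compact interval $[0,a]$, $a$ being the distance of the two points), and whenever two geodesic segments $[x,y]$, $[y,z]$ have only the endpoint $y$ in common, their union is the geodesic segment $[x,z]$. The valency of a point $t\in T$ is the cardinality of the set of connected components of $T\setminus\{t\}$. Let $\mu\ge 2$ be a cardinal, and let $C_\mu$ be a set containing an element $0$, with $\operatorname{Card}(C_\mu)=\mu$ if $C_\mu$ is infinite and $\operatorname{Card}(C_\mu)=\mu-1$ otherwise. Let $A_\mu$ be the set of all functions $f:(-\infty,\rho_f)\to C_\mu$, $\rho_f\in\mathbb R$, such that (1) there is $\tau_f\le\rho_f$ with $f(t)=0$ for all $t<\tau_f$, and (2) for every $t<\rho_f$ there is $\varepsilon>0$ with $t+\varepsilon<\rho_f$ such that $f$ is constant on $[t,t+\varepsilon]$. Equip $A_\mu$ with the metric $$d(f_1,f_2)=(\rho_{f_1}-s)+(\rho_{f_2}-s),\qquad s=\sup\{t\le\min(\rho_{f_1},\rho_{f_2}) : f_1(t')=f_2(t')\ \text{for all } t'<t\}.$$ Then $A_\mu$ is a complete $\mathbb R$-tree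 with valency $\mu$ at every point, and: (i) (universality) $A_\mu$ is a $\mu$-universal $\mathbb R$-tree: it is an $\mathbb R$-tree, and every $\mathbb R$-tree whose valency is at most $\mu$ at every point embeds isometrically into $A_\mu$; (ii) (uniqueness) every non-empty complete $\mathbb R$-tree with valency exactly $\mu$ at every point is isometric to $A_\mu$; (iii) (homogeneity) for any $f,g\in A_\mu$ there is an isometry of $A_\mu$ onto itself that maps $f$ to $g$. -/

import Mathlib

universe u v

namespace UniversalTree

/-! ## Real trees, valency, universality, homogeneity -/

/-- `S` is a geodesic segment joining `x` to `y`: the image of an isometric inclusion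
`F : [0, a] → T`, `a = dist x y`, with `F 0 = x` and `F a = y`. -/
def IsGeodesicSegment {T : Type*} [MetricSpace T] (x y : T) (S : Set T) : Prop :=
  ∃ F : ℝ → T,
    (∀ s ∈ Set.Icc 0 (dist x y), ∀ t ∈ Set.Icc 0 (dist x y), dist (F s) (F t) = |s - t|) ∧
    F 0 = x ∧ F (dist x y) = y ∧ F '' Set.Icc 0 (dist x y) = S

/-- A real tree: any two points are joined by a unique geodesic segment, and if two geodesic
segments `[x, y]`, `[y, z]` have only the endpoint `y` in common, then their union is the
geodesic segment `[x, z]`. -/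
def IsRealTree (T : Type*) [MetricSpace T] : Prop :=
  (∀ x y : T, ∃! S : Set T, IsGeodesicSegment x y S) ∧
  ∀ (x y z : T) (S S' : Set T), IsGeodesicSegment x y S → IsGeodesicSegment y z S' →
    S ∩ S' = {y} → IsGeodesicSegment x z (S ∪ S')

/-- The valency of `t`: the cardinality of the set of connected components of `T \ {t}`. -/
noncomputable def valency {T : Type v} [MetricSpace T] (t : T) : Cardinal.{v} :=
  Cardinal.mk (ConnectedComponents ({t}ᶜ : Set T))

/-- `X` is a `μ`-universal real tree: it is a real tree, and every real tree (in the universe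
`Type v`) whose valency is at most `μ` at every point embeds isometrically into it. -/
def IsUniversalRealTree (μ : Cardinal.{u}) (X : Type u) [MetricSpace X] : Prop :=
  IsRealTree X ∧
  ∀ (T : Type v) [MetricSpace T], IsRealTree T →
    (∀ t : T, Cardinal.lift.{u} (valency t) ≤ Cardinal.lift.{v} μ) →
    ∃ F : T → X, Isometry F

/-- Any point can be moved to any other by a surjective isometry of the space onto itself. -/
def IsHomogeneous (X : Type*) [MetricSpace X] : Prop :=
  ∀ x y : X, ∃ e : X ≃ᵢ X, e x = y

/-! ## The function space -/

/-- `C` is an admissible set of values for the cardinal `μ`: its cardinality is `μ` if `C` is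
infinite, and `μ - 1` otherwise. -/
def IsValueSet (μ : Cardinal.{u}) (C : Type u) : Prop :=
  (Infinite C → Cardinal.mk C = μ) ∧ (Finite C → Cardinal.mk C + 1 = μ)

/-- The set of functions `f : (-∞, ρ) → C` (with `ρ` depending on `f`) that vanish near `-∞` and
are piecewise constant from the right. -/
structure FunctionTree (C : Type u) [Zero C] : Type u where
  /-- the right end of the domain -/
  rho : ℝ
  /-- the function itself -/
  toFun : Set.Iio rho → C
  zero_near_bot : ∃ τ ≤ rho, ∀ t : Set.Iio rho, (t : ℝ) < τ → toFun t = 0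
  const_right : ∀ t : Set.Iio rho, ∃ ε > 0, (t : ℝ) + ε < rho ∧
    ∀ t' : Set.Iio rho, (t' : ℝ) ∈ Set.Icc (t : ℝ) (t + ε) → toFun t' = toFun t

namespace FunctionTree

variable {C : Type u} [Zero C]

/-- `f` and `g` are both defined and equal on `(-∞, t)`. -/
def AgreeBelow (f g : FunctionTree C) (t : ℝ) : Prop :=
  ∃ (hf : t ≤ f.rho) (hg : t ≤ g.rho), ∀ (t' : ℝ) (ht : t' < t),
    f.toFun ⟨t', lt_of_lt_of_le ht hf⟩ = g.toFun ⟨t', lt_of_lt_of_le ht hg⟩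

/-- The separation moment of `f` and `g`. -/
noncomputable def sep (f g : FunctionTree C) : ℝ := sSup {t : ℝ | AgreeBelow f g t}

theorem agreeBelow_refl (f : FunctionTree C) : AgreeBelow f f f.rho :=
  ⟨le_rfl, le_rfl, fun _ _ => rfl⟩

theorem AgreeBelow.symm {f g : FunctionTree C} {t : ℝ} (h : AgreeBelow f g t) :
    AgreeBelow g f t := by
  obtain ⟨hf, hg, h⟩ := h
  exact ⟨hg, hf, fun t' ht => (h t' ht).symm⟩

theorem AgreeBelow.trans {f g k : FunctionTree C} {t : ℝ} (h : AgreeBelow f g t)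
    (h' : AgreeBelow g k t) : AgreeBelow f k t := by
  obtain ⟨hf, hg, h⟩ := h
  obtain ⟨_, hk, h'⟩ := h'
  exact ⟨hf, hk, fun t' ht => (h t' ht).trans (h' t' ht)⟩

theorem AgreeBelow.mono {f g : FunctionTree C} {s t : ℝ} (h : AgreeBelow f g t) (hst : s ≤ t) :
    AgreeBelow f g s := by
  obtain ⟨hf, hg, h⟩ := h
  exact ⟨hst.trans hf, hst.trans hg, fun t' ht => h t' (ht.trans_le hst)⟩

theorem exists_agreeBelow (f g : FunctionTree C) : ∃ t, AgreeBelow f g t := by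
  obtain ⟨a, ha, hfa⟩ := f.zero_near_bot
  obtain ⟨b, hb, hgb⟩ := g.zero_near_bot
  refine ⟨min a b, (min_le_left a b).trans ha, (min_le_right a b).trans hb, fun t' ht => ?_⟩
  rw [hfa _ (ht.trans_le (min_le_left a b)), hgb _ (ht.trans_le (min_le_right a b))]

theorem bddAbove_agreeBelow (f g : FunctionTree C) : BddAbove {t : ℝ | AgreeBelow f g t} :=
  ⟨f.rho, fun _ ht => ht.1⟩

/-- The supremum defining the separation moment is attained. -/
theorem agreeBelow_sep (f g : FunctionTree C) : AgreeBelow f g (sep f g) := by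
  have hne : {t : ℝ | AgreeBelow f g t}.Nonempty := exists_agreeBelow f g
  refine ⟨csSup_le hne fun _ ht => ht.1, csSup_le hne fun _ ht => ht.2.1, fun t' ht => ?_⟩
  obtain ⟨t, hagree, hlt⟩ := exists_lt_of_lt_csSup hne ht
  exact hagree.2.2 t' hlt

theorem le_sep {f g : FunctionTree C} {t : ℝ} (h : AgreeBelow f g t) : t ≤ sep f g :=
  le_csSup (bddAbove_agreeBelow f g) h

theorem sep_comm (f g : FunctionTree C) : sep f g = sep g f :=
  le_antisymm (le_sep (agreeBelow_sep f g).symm) (le_sep (agreeBelow_sep g f).symm)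

theorem sep_le_left (f g : FunctionTree C) : sep f g ≤ f.rho := (agreeBelow_sep f g).1

theorem sep_le_right (f g : FunctionTree C) : sep f g ≤ g.rho := (agreeBelow_sep f g).2.1

theorem sep_self (f : FunctionTree C) : sep f f = f.rho :=
  le_antisymm (sep_le_left f f) (le_sep (agreeBelow_refl f))

theorem min_sep_le (f g k : FunctionTree C) : min (sep f g) (sep g k) ≤ sep f k :=
  le_sep (((agreeBelow_sep f g).mono (min_le_left _ _)).trans
    ((agreeBelow_sep g k).mono (min_le_right _ _)))

theorem eq_of_agreeBelow {f g : FunctionTree C} {t : ℝ} (h : AgreeBelow f g t)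
    (hf : f.rho = t) (hg : g.rho = t) : f = g := by
  obtain ⟨r, F, hF, hF'⟩ := f
  obtain ⟨r', G, hG, hG'⟩ := g
  simp only at hf hg
  subst hf
  subst hg
  obtain ⟨_, _, h⟩ := h
  have : F = G := funext fun t' => h t'.1 t'.2
  subst this
  rfl

/-- The metric `d(f, g) = (ρ_f - s) + (ρ_g - s)`, where `s` is the separation moment. -/
noncomputable instance : MetricSpace (FunctionTree C) where
  dist f g := (f.rho - sep f g) + (g.rho - sep f g)
  dist_self f := by simp [sep_self]
  dist_comm f g := by rw [sep_comm f g, add_comm]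
  dist_triangle f g k := by
    have h1 := min_sep_le f g k
    have h2 := sep_le_right f g
    have h3 := sep_le_left g k
    rcases le_total (sep f g) (sep g k) with h | h
    · rw [min_eq_left h] at h1
      linarith
    · rw [min_eq_right h] at h1
      linarith
  eq_of_dist_eq_zero {f g} h := by
    have h1 := sep_le_left f g
    have h2 := sep_le_right f g
    change (f.rho - sep f g) + (g.rho - sep f g) = 0 at h
    exact eq_of_agreeBelow (agreeBelow_sep f g) (by linarith) (by linarith)

end FunctionTree

end UniversalTree

namespace UniversalTree

/-! Real trees are the geodesic spaces satisfying the four-point condition. In such a space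
"positive Gromov product at `p`" is an equivalence relation off `p`, and its classes, the directions
at `p`, are the components of the complement of `p`. At a point `f` of the function space they are
indexed by `Option C`: down along `f` (`none`), or up through a next value `c`. Hence the valency is
`Card C + 1 = μ`. Universality, uniqueness and homogeneity all follow from one extension theorem,
`IsGeodesicHyperbolic.exists_isometry`. Zorn's lemma is applied to isometries from convex subsets of
`T` that carry, at each point of the domain, a labelling of the directions of `T` matching the
labels in the target. The labels ensure that a new direction of `T` can always be sent to an unused
direction of the target, even after infinitely many choices. A point outside a maximal domain has a
gate `q` in the closure of that domain: if `q` is in the domain, a short segment can be attached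
(`extend_segment`); if not, completeness of the target supplies an image of `q` (`extend_closure`).
When every label is used and `T` is complete, the image is closed, convex and misses no direction,
so it is the whole target. -/

/-- The Gromov product of `x` and `y` with respect to `p`. -/
noncomputable def gromovProduct {X : Type*} [MetricSpace X] (p x y : X) : ℝ :=
  (dist p x + dist p y - dist x y) / 2

/-- `w` lies metrically between `x` and `y`. -/
def Btw {X : Type*} [MetricSpace X] (x w y : X) : Prop := dist x w + dist w y = dist x y

/-- A geodesic space satisfying the four-point condition. -/
structure IsGeodesicHyperbolic (X : Type*) [MetricSpace X] : Prop where
  exists_between : ∀ (x y : X) (r : ℝ), 0 ≤ r → r ≤ dist x y →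
    ∃ z, dist x z = r ∧ dist z y = dist x y - r
  four_point : ∀ x y z w : X,
    dist x y + dist z w ≤ max (dist x z + dist y w) (dist x w + dist y z)

/-- `F` parametrizes a geodesic from `x` to `y` by arc length. -/
def IsGeodesicParam {X : Type*} [MetricSpace X] (F : ℝ → X) (x y : X) : Prop :=
  (∀ s ∈ Set.Icc 0 (dist x y), ∀ t ∈ Set.Icc 0 (dist x y), dist (F s) (F t) = |s - t|) ∧
    F 0 = x ∧ F (dist x y) = y

/-! ### Gromov products and betweenness -/

section Basic

variable {X : Type*} [MetricSpace X]

theorem gromovProduct_nonneg (p x y : X) : 0 ≤ gromovProduct p x y := by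
  have := dist_triangle x p y
  rw [dist_comm x p] at this
  unfold gromovProduct
  linarith

theorem gromovProduct_comm (p x y : X) : gromovProduct p x y = gromovProduct p y x := by
  unfold gromovProduct
  rw [dist_comm x y]
  ring

theorem gromovProduct_le_left (p x y : X) : gromovProduct p x y ≤ dist p x := by
  have := dist_triangle p x y
  unfold gromovProduct
  linarith

theorem gromovProduct_le_right (p x y : X) : gromovProduct p x y ≤ dist p y := by
  rw [gromovProduct_comm]
  exact gromovProduct_le_left p y x

theorem gromovProduct_self (p x : X) : gromovProduct p x x = dist p x := by
  simp [gromovProduct]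

theorem le_gromovProduct (p x y : X) : dist p x - dist x y ≤ gromovProduct p x y := by
  have := dist_triangle p y x
  rw [dist_comm y x] at this
  unfold gromovProduct
  linarith

theorem gromovProduct_eq_zero_iff {p x y : X} : gromovProduct p x y = 0 ↔ Btw x p y := by
  unfold gromovProduct Btw
  rw [dist_comm x p]
  constructor <;> intro h <;> linarith

theorem Btw.symm {x w y : X} (h : Btw x w y) : Btw y w x := by
  unfold Btw at *
  rw [dist_comm y w, dist_comm w x, dist_comm y x]
  linarith

theorem btw_left (x y : X) : Btw x x y := by simp [Btw]

theorem Btw.gromovProduct_eq {x w y : X} (h : Btw x w y) : gromovProduct x w y = dist x w := by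
  unfold Btw at h
  unfold gromovProduct
  linarith

theorem Btw.trans_left {x w y z : X} (h : Btw x w y) (h' : Btw x y z) : Btw x w z := by
  unfold Btw at *
  have := dist_triangle x w z
  have := dist_triangle w y z
  linarith

/-- If `w` is between `x` and `y` and `y` between `x` and `z`, then `y` is between `w` and `z`. -/
theorem Btw.trans_right {x w y z : X} (h : Btw x w y) (h' : Btw x y z) : Btw w y z := by
  unfold Btw at *
  have := dist_triangle x w z
  have := dist_triangle w y z
  linarith

end Basic

/-! ### Consequences of the four-point condition -/

namespace IsGeodesicHyperbolic

variable {X : Type*} [MetricSpace X] (h : IsGeodesicHyperbolic X)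
include h

/-- The four-point condition in ultrametric form; it makes "same direction at `p`" transitive. -/
theorem min_gromovProduct_le (p x y z : X) :
    min (gromovProduct p x y) (gromovProduct p y z) ≤ gromovProduct p x z := by
  unfold gromovProduct
  have := h.four_point x z y p
  rw [dist_comm z p, dist_comm x p, dist_comm y p, dist_comm z y] at this
  rcases le_max_iff.1 this with h1 | h1
  · exact (min_le_left _ _).trans (by linarith)
  · exact (min_le_right _ _).trans (by linarith)

theorem le_gromovProduct_trans {p x y z : X} {a : ℝ} (h1 : a ≤ gromovProduct p x y)
    (h2 : a ≤ gromovProduct p y z) : a ≤ gromovProduct p x z :=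
  (le_min h1 h2).trans (h.min_gromovProduct_le p x y z)

theorem gromovProduct_pos_trans {p x y z : X} (h1 : 0 < gromovProduct p x y)
    (h2 : 0 < gromovProduct p y z) : 0 < gromovProduct p x z :=
  (lt_min h1 h2).trans_le (h.min_gromovProduct_le p x y z)

/-- On a segment, the distance between two points is determined by the distances to one end. -/
theorem dist_of_btw {x y a b : X} (ha : Btw x a y) (hb : Btw x b y)
    (hab : dist x a ≤ dist x b) : Btw x a b := by
  have h1 : dist x a ≤ gromovProduct x a b := by
    refine h.le_gromovProduct_trans (y := y) ha.gromovProduct_eq.ge ?_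
    rw [gromovProduct_comm, hb.gromovProduct_eq]
    exact hab
  have := dist_triangle x a b
  unfold gromovProduct at h1
  unfold Btw
  linarith

theorem eq_of_btw {x y a b : X} (ha : Btw x a y) (hb : Btw x b y)
    (hab : dist x a = dist x b) : a = b := by
  have := h.dist_of_btw ha hb hab.le
  unfold Btw at this
  exact dist_le_zero.1 (by linarith)

theorem btw_or_btw {x y a b : X} (ha : Btw x a y) (hb : Btw x b y) : Btw x b a ∨ Btw a b y := by
  rcases le_total (dist x b) (dist x a) with hab | hab
  · exact Or.inl (h.dist_of_btw hb ha hab)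
  · exact Or.inr ((h.dist_of_btw ha hb hab).trans_right hb)

/-- Being closer to `q` than `z` is, `u` lies in the direction of `q` from `z`, so `z` separates `p`
from `u` as well. -/
theorem btw_of_dist_lt {p z q u : X} (hz : Btw p z q) (hu : dist q u < dist z q) :
    Btw p z u := by
  have h0 := gromovProduct_eq_zero_iff.2 hz
  have h1 : 0 < gromovProduct z q u := by
    have := le_gromovProduct z q u
    linarith
  rw [← gromovProduct_eq_zero_iff]
  refine le_antisymm (not_lt.1 fun h2 => ?_) (gromovProduct_nonneg _ _ _)
  rw [gromovProduct_comm] at h1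
  exact (h.gromovProduct_pos_trans h2 h1).ne' h0

theorem exists_param (x y : X) : ∃ F : ℝ → X, IsGeodesicParam F x y := by
  have hex : ∀ r : ℝ, ∃ z, r ∈ Set.Icc 0 (dist x y) →
      dist x z = r ∧ dist z y = dist x y - r := by
    intro r
    by_cases hr : r ∈ Set.Icc 0 (dist x y)
    · obtain ⟨z, hz⟩ := h.exists_between x y r hr.1 hr.2
      exact ⟨z, fun _ => hz⟩
    · exact ⟨x, fun h' => absurd h' hr⟩
  choose F hF using hex
  have hbtw : ∀ r ∈ Set.Icc 0 (dist x y), Btw x (F r) y := fun r hr => by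
    obtain ⟨h1, h2⟩ := hF r hr
    unfold Btw
    linarith
  refine ⟨F, ?_, ?_, ?_⟩
  · have key : ∀ s ∈ Set.Icc 0 (dist x y), ∀ t ∈ Set.Icc 0 (dist x y), s ≤ t →
        dist (F s) (F t) = |s - t| := by
      intro s hs t ht hst
      have := h.dist_of_btw (hbtw s hs) (hbtw t ht) (by rw [(hF s hs).1, (hF t ht).1]; exact hst)
      unfold Btw at this
      rw [(hF s hs).1, (hF t ht).1] at this
      rw [abs_sub_comm, abs_of_nonneg (by linarith)]
      linarith
    intro s hs t ht
    rcases le_total s t with hst | hst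
    · exact key s hs t ht hst
    · rw [dist_comm, abs_sub_comm]
      exact key t ht s hs hst
  · exact (dist_eq_zero.1 (hF 0 ⟨le_rfl, dist_nonneg⟩).1).symm
  · have := (hF (dist x y) ⟨dist_nonneg, le_rfl⟩).2
    rw [sub_self] at this
    exact dist_eq_zero.1 this

end IsGeodesicHyperbolic

namespace IsGeodesicParam

variable {X : Type*} [MetricSpace X] {F : ℝ → X} {x y : X} (hF : IsGeodesicParam F x y)
include hF

theorem dist_left {t : ℝ} (ht : t ∈ Set.Icc 0 (dist x y)) : dist x (F t) = t := by
  have := hF.1 0 ⟨le_rfl, dist_nonneg⟩ t ht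
  rw [hF.2.1] at this
  rw [this, zero_sub, abs_neg, abs_of_nonneg ht.1]

theorem dist_right {t : ℝ} (ht : t ∈ Set.Icc 0 (dist x y)) : dist (F t) y = dist x y - t := by
  have := hF.1 t ht (dist x y) ⟨dist_nonneg, le_rfl⟩
  rw [hF.2.2] at this
  rw [this, abs_sub_comm, abs_of_nonneg (by linarith [ht.2])]

theorem btw {t : ℝ} (ht : t ∈ Set.Icc 0 (dist x y)) : Btw x (F t) y := by
  unfold Btw
  rw [hF.dist_left ht, hF.dist_right ht]
  ring

theorem isGeodesicSegment : IsGeodesicSegment x y (F '' Set.Icc 0 (dist x y)) :=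
  ⟨F, hF.1, hF.2.1, hF.2.2, rfl⟩

theorem subparam {a b : ℝ} (ha : 0 ≤ a) (hab : a ≤ b) (hb : b ≤ dist x y) :
    IsGeodesicParam (fun u => F (a + u)) (F a) (F b) := by
  have hd : dist (F a) (F b) = b - a := by
    rw [hF.1 a ⟨ha, hab.trans hb⟩ b ⟨ha.trans hab, hb⟩, abs_sub_comm, abs_of_nonneg (by linarith)]
  refine ⟨fun s hs t ht => ?_, by simp, by simp [hd]⟩
  rw [hd] at hs ht
  have := hF.1 (a + s) ⟨by linarith [hs.1], by linarith [hs.2]⟩ (a + t)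
    ⟨by linarith [ht.1], by linarith [ht.2]⟩
  simpa using this

theorem reverse : IsGeodesicParam (fun u => F (dist x y - u)) y x := by
  refine ⟨fun s hs t ht => ?_, by simp [hF.2.2], by simp [dist_comm y x, hF.2.1]⟩
  rw [dist_comm y x] at hs ht
  rw [hF.1 _ ⟨by linarith [hs.2], by linarith [hs.1]⟩ _ ⟨by linarith [ht.2], by linarith [ht.1]⟩]
  rw [abs_sub_comm]
  congr 1
  ring

end IsGeodesicParam

/-! ### Equivalence with the definition by segments -/

namespace IsRealTree

variable {T : Type*} [MetricSpace T] (h : IsRealTree T)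
include h

theorem exists_param (x y : T) : ∃ F : ℝ → T, IsGeodesicParam F x y := by
  obtain ⟨S, ⟨F, h1, h2, h3, -⟩, -⟩ := h.1 x y
  exact ⟨F, h1, h2, h3⟩

/-- The segment from `w` to the common point is unique, and a point on it is determined by its
distance to `w`. -/
theorem param_eq_of_eq {w x y : T} {F G : ℝ → T} (hF : IsGeodesicParam F w x)
    (hG : IsGeodesicParam G w y) {t : ℝ} (htx : t ≤ dist w x) (hty : t ≤ dist w y)
    (hFG : F t = G t) {s : ℝ} (hs : 0 ≤ s) (hst : s ≤ t) : F s = G s := by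
  have ht : 0 ≤ t := hs.trans hst
  have hd : dist w (F t) = t := hF.dist_left ⟨ht, htx⟩
  have h1 : IsGeodesicParam F w (F t) := by
    simpa [hF.2.1] using hF.subparam le_rfl ht htx
  have h2 : IsGeodesicParam G w (F t) := by
    rw [hFG]
    simpa [hG.2.1] using hG.subparam le_rfl ht hty
  have he := (h.1 w (F t)).unique h1.isGeodesicSegment h2.isGeodesicSegment
  rw [hd] at he
  obtain ⟨s', hs', hss⟩ : F s ∈ G '' Set.Icc 0 t := he ▸ ⟨s, ⟨hs, hst⟩, rfl⟩
  have e1 := hF.dist_left (t := s) ⟨hs, hst.trans htx⟩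
  have e2 := hG.dist_left (t := s') ⟨hs'.1, hs'.2.trans hty⟩
  rw [hss, e1] at e2
  rw [← hss, ← e2]

/-- Two geodesics from `w` agree up to the Gromov product of their ends. -/
theorem exists_branch {w x y : T} {F G : ℝ → T} (hF : IsGeodesicParam F w x)
    (hG : IsGeodesicParam G w y) : F (gromovProduct w x y) = G (gromovProduct w x y) := by
  -- Beyond the last agreement time `m` the two geodesics are disjoint, so the second axiom joins
  -- their tails into a segment `[x, y]`. Computing its length identifies `m` with the Gromov
  -- product.
  set A : Set ℝ := {t | 0 ≤ t ∧ t ≤ dist w x ∧ t ≤ dist w y ∧ F t = G t} with hA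
  have hne : A.Nonempty := ⟨0, le_rfl, dist_nonneg, dist_nonneg, hF.2.1.trans hG.2.1.symm⟩
  have hbd : BddAbove A := ⟨dist w x, fun t ht => ht.2.1⟩
  set m := sSup A with hm
  have hm0 : 0 ≤ m := le_csSup hbd ⟨le_rfl, dist_nonneg, dist_nonneg, hF.2.1.trans hG.2.1.symm⟩
  have hmx : m ≤ dist w x := csSup_le hne fun t ht => ht.2.1
  have hmy : m ≤ dist w y := csSup_le hne fun t ht => ht.2.2.1
  have hFG : F m = G m := by
    refine dist_le_zero.1 (le_of_forall_pos_le_add fun ε hε => ?_)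
    obtain ⟨t, ht, htm⟩ := exists_lt_of_lt_csSup hne (show m - ε / 2 < sSup A by linarith)
    have htm' : t ≤ m := le_csSup hbd ht
    have e1 := hF.1 m ⟨hm0, hmx⟩ t ⟨ht.1, ht.2.1⟩
    have e2 := hG.1 t ⟨ht.1, ht.2.2.1⟩ m ⟨hm0, hmy⟩
    rw [abs_of_nonneg (by linarith)] at e1
    rw [abs_sub_comm, abs_of_nonneg (by linarith)] at e2
    have := dist_triangle (F m) (F t) (G m)
    rw [ht.2.2.2] at this e1
    linarith
  have hSF := ((hF.subparam hm0 hmx le_rfl).reverse).isGeodesicSegment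
  have hSG := (hG.subparam hm0 hmy le_rfl).isGeodesicSegment
  rw [hF.2.2] at hSF
  rw [hG.2.2, ← hFG] at hSG
  have hdx : dist (F m) x = dist w x - m := hF.dist_right ⟨hm0, hmx⟩
  have hdy : dist (F m) y = dist w y - m := hFG ▸ hG.dist_right ⟨hm0, hmy⟩
  have hinter : ((fun u => F (m + (dist (F m) x - u))) '' Set.Icc 0 (dist x (F m))) ∩
      ((fun u => G (m + u)) '' Set.Icc 0 (dist (F m) y)) = {F m} := by
    apply Set.eq_singleton_iff_unique_mem.2
    refine ⟨⟨⟨dist (F m) x, ⟨dist_nonneg, (dist_comm _ _).le⟩, by simp⟩,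
      ⟨0, ⟨le_rfl, dist_nonneg⟩, by simp [hFG]⟩⟩, ?_⟩
    rintro z ⟨⟨s, hs, rfl⟩, ⟨t, ht, htz⟩⟩
    simp only at htz ⊢
    rw [dist_comm x, hdx] at hs
    rw [hdy] at ht
    rw [hdx] at htz ⊢
    have e1 := hF.dist_left (t := m + (dist w x - m - s))
      ⟨by linarith [hs.2], by linarith [hs.1]⟩
    have e2 := hG.dist_left (t := m + t) ⟨by linarith [ht.1], by linarith [ht.2]⟩
    rw [htz, e1] at e2
    have hmem : m + t ∈ A := ⟨by linarith [ht.1], by linarith [hs.1], by linarith [ht.2], by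
      rw [htz, ← e2]⟩
    have := le_csSup hbd hmem
    rw [e2]
    congr 1
    linarith [ht.1]
  obtain ⟨K, hK1, hK2, hK3, hK4⟩ := h.2 x (F m) y _ _ hSF hSG hinter
  have hK : IsGeodesicParam K x y := ⟨hK1, hK2, hK3⟩
  obtain ⟨t, ht, htK⟩ : F m ∈ K '' Set.Icc 0 (dist x y) :=
    hK4 ▸ Or.inr ⟨0, ⟨le_rfl, dist_nonneg⟩, by simp [hFG]⟩
  have e1 := hK.dist_left ht
  have e2 := hK.dist_right ht
  rw [htK, dist_comm, hdx] at e1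
  rw [htK, hdy] at e2
  have : gromovProduct w x y = m := by
    unfold gromovProduct
    linarith
  rw [this, hFG]

/-- The geodesics from `w` to `x`, `z`, `y` coincide up to the smaller product `m`, so `x` and `y`
are joined through a common point at distance `m` from `w`. -/
theorem isGeodesicHyperbolic : IsGeodesicHyperbolic T where
  exists_between x y r h0 hr := by
    obtain ⟨F, hF⟩ := h.exists_param x y
    exact ⟨F r, hF.dist_left ⟨h0, hr⟩, hF.dist_right ⟨h0, hr⟩⟩
  four_point x y z w := by
    obtain ⟨F, hF⟩ := h.exists_param w x
    obtain ⟨G, hG⟩ := h.exists_param w y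
    obtain ⟨H, hH⟩ := h.exists_param w z
    set m := min (gromovProduct w x z) (gromovProduct w z y) with hm
    have hm0 : 0 ≤ m := le_min (gromovProduct_nonneg _ _ _) (gromovProduct_nonneg _ _ _)
    have h1 : F m = H m := h.param_eq_of_eq hF hH (gromovProduct_le_left _ _ _)
      (gromovProduct_le_right _ _ _) (h.exists_branch hF hH) hm0 (min_le_left _ _)
    have h2 : H m = G m := h.param_eq_of_eq hH hG (gromovProduct_le_left _ _ _)
      (gromovProduct_le_right _ _ _) (h.exists_branch hH hG) hm0 (min_le_right _ _)
    have e1 := hF.dist_right (t := m)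
      ⟨hm0, (min_le_left _ _).trans (gromovProduct_le_left _ _ _)⟩
    have e2 := hG.dist_right (t := m)
      ⟨hm0, (min_le_right _ _).trans (gromovProduct_le_right _ _ _)⟩
    rw [h1, h2] at e1
    have e3 := dist_triangle x (G m) y
    rw [dist_comm x (G m), e1, e2] at e3
    unfold gromovProduct at hm
    rw [dist_comm z w, dist_comm x w, dist_comm y w, dist_comm y z]
    rcases min_choice ((dist w x + dist w z - dist x z) / 2)
      ((dist w z + dist w y - dist z y) / 2) with h' | h' <;> rw [h'] at hm
    · exact le_max_iff.2 (Or.inl (by linarith))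
    · exact le_max_iff.2 (Or.inr (by linarith))

end IsRealTree

theorem IsGeodesicHyperbolic.isRealTree {X : Type*} [MetricSpace X]
    (h : IsGeodesicHyperbolic X) : IsRealTree X := by
  constructor
  · intro x y
    obtain ⟨F, hF⟩ := h.exists_param x y
    refine ⟨_, hF.isGeodesicSegment, ?_⟩
    rintro S ⟨G, h1, h2, h3, rfl⟩
    have hG : IsGeodesicParam G x y := ⟨h1, h2, h3⟩
    exact Set.image_congr fun t ht =>
      h.eq_of_btw (hG.btw ht) (hF.btw ht) ((hG.dist_left ht).trans (hF.dist_left ht).symm)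
  · rintro x y z S S' ⟨F, h1, h2, h3, rfl⟩ ⟨G, h1', h2', h3', rfl⟩ hinter
    have hF : IsGeodesicParam F x y := ⟨h1, h2, h3⟩
    have hG : IsGeodesicParam G y z := ⟨h1', h2', h3'⟩
    have hxz : Btw x y z := by
      rw [← gromovProduct_eq_zero_iff]
      set e := gromovProduct y x z with he
      have he0 : 0 ≤ e := gromovProduct_nonneg _ _ _
      have hex : e ≤ dist y x := gromovProduct_le_left _ _ _
      have hez : e ≤ dist y z := gromovProduct_le_right _ _ _
      have ha := (hF.reverse).btw ⟨he0, hex⟩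
      have hb := hG.btw ⟨he0, hez⟩
      have da := (hF.reverse).dist_left ⟨he0, hex⟩
      have db := hG.dist_left ⟨he0, hez⟩
      -- The points at distance `e` from `y` on the two segments have product at least `e`, which
      -- forces them to coincide. The segments meet only at `y`, so `e = 0`.
      have hab : e ≤ gromovProduct y (F (dist x y - e)) (G e) := by
        refine h.le_gromovProduct_trans (y := x) (ha.gromovProduct_eq.trans da).ge ?_
        refine h.le_gromovProduct_trans (y := z) le_rfl ?_
        rw [gromovProduct_comm]
        exact (hb.gromovProduct_eq.trans db).ge
      have hab' : F (dist x y - e) = G e := by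
        unfold gromovProduct at hab
        exact dist_le_zero.1 (by linarith)
      have : G e ∈ ({y} : Set X) := by
        rw [← hinter]
        refine ⟨⟨dist x y - e, ⟨?_, by linarith⟩, hab'⟩, ⟨e, ⟨he0, hez⟩, rfl⟩⟩
        rw [dist_comm x y]
        linarith
      rw [Set.mem_singleton_iff.1 this, dist_self] at db
      exact db.symm
    have hd : dist x z = dist x y + dist y z := Eq.symm hxz
    refine ⟨fun s => if s ≤ dist x y then F s else G (s - dist x y), ?_, ?_, ?_, ?_⟩
    · have key : ∀ s ∈ Set.Icc 0 (dist x y), ∀ t, dist x y < t → t ≤ dist x z →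
          dist (F s) (G (t - dist x y)) = |s - t| := by
        intro s hs t ht htz
        have ht' : t - dist x y ∈ Set.Icc 0 (dist y z) := ⟨by linarith, by linarith⟩
        have := hF.dist_left hs
        have := hF.dist_right hs
        have := hG.dist_left ht'
        have := hG.dist_right ht'
        have := dist_triangle (F s) y (G (t - dist x y))
        have := dist_triangle x (F s) z
        have := dist_triangle (F s) (G (t - dist x y)) z
        rw [abs_sub_comm, abs_of_nonneg (by linarith [hs.2])]
        linarith
      intro s hs t ht
      by_cases hsx : s ≤ dist x y <;> by_cases htx : t ≤ dist x y <;> simp only [hsx, htx, if_true,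
        if_false]
      · exact hF.1 s ⟨hs.1, hsx⟩ t ⟨ht.1, htx⟩
      · exact key s ⟨hs.1, hsx⟩ t (not_le.1 htx) ht.2
      · rw [dist_comm, abs_sub_comm]
        exact key t ⟨ht.1, htx⟩ s (not_le.1 hsx) hs.2
      · push Not at hsx htx
        rw [hG.1 _ ⟨by linarith, by linarith [hs.2]⟩ _ ⟨by linarith, by linarith [ht.2]⟩]
        congr 1
        ring
    · simp [hF.2.1]
    · simp only
      split_ifs with hle
      · have : dist y z = 0 := le_antisymm (by linarith) dist_nonneg
        rw [hd, this, add_zero, hF.2.2]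
        exact dist_eq_zero.1 this
      · rw [hd, add_sub_cancel_left, hG.2.2]
    · ext w
      constructor
      · rintro ⟨s, hs, rfl⟩
        simp only
        split_ifs with hle
        · exact Or.inl ⟨s, ⟨hs.1, hle⟩, rfl⟩
        · exact Or.inr ⟨s - dist x y, ⟨by linarith, by linarith [hs.2]⟩, rfl⟩
      · rintro (⟨s, hs, rfl⟩ | ⟨s, hs, rfl⟩)
        · exact ⟨s, ⟨hs.1, by linarith [hs.2, dist_nonneg (x := y) (y := z)]⟩, by simp [hs.2]⟩
        · refine ⟨dist x y + s, ⟨by linarith [hs.1, dist_nonneg (x := x) (y := y)],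
            by linarith [hs.2]⟩, ?_⟩
          simp only
          split_ifs with hle
          · have : s = 0 := le_antisymm (by linarith) hs.1
            rw [this, add_zero, hF.2.2, hG.2.1]
          · rw [add_sub_cancel_left]

/-! ### Convex sets and gates -/

/-- `S` contains every point between two of its points. -/
def IsBtwConvex {X : Type*} [MetricSpace X] (S : Set X) : Prop :=
  ∀ p ∈ S, ∀ q ∈ S, ∀ w, Btw p w q → w ∈ S

namespace IsGeodesicHyperbolic

variable {X : Type*} [MetricSpace X] (h : IsGeodesicHyperbolic X)
include h

theorem mem_of_btw_closure {S : Set X} (hS : IsBtwConvex S) {p z q : X} (hp : p ∈ S)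
    (hq : q ∈ closure S) (hz : Btw p z q) (hzq : z ≠ q) : z ∈ S := by
  obtain ⟨u, hu, hqu⟩ := Metric.mem_closure_iff.1 hq (dist z q) (dist_pos.2 hzq)
  exact hS p hp u hu z (h.btw_of_dist_lt hz hqu)

/-- A convex set has a point in its closure through which all paths to `x` pass. -/
theorem exists_gate {S : Set X} (hS : IsBtwConvex S) (hne : S.Nonempty) (x : X) :
    ∃ q ∈ closure S, ∀ p ∈ S, Btw p q x := by
  obtain ⟨a, ha⟩ := hne
  obtain ⟨F, hF⟩ := h.exists_param a x
  set A : Set ℝ := {r | r ∈ Set.Icc 0 (dist a x) ∧ F r ∈ S} with hA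
  have h0 : (0 : ℝ) ∈ A := ⟨⟨le_rfl, dist_nonneg⟩, by rw [hF.2.1]; exact ha⟩
  have hbd : BddAbove A := ⟨dist a x, fun t ht => ht.1.2⟩
  set m := sSup A with hm
  have hmI : m ∈ Set.Icc 0 (dist a x) :=
    ⟨le_csSup hbd h0, csSup_le ⟨0, h0⟩ fun t ht => ht.1.2⟩
  have hcl : F m ∈ closure S := by
    refine Metric.mem_closure_iff.2 fun ε hε => ?_
    obtain ⟨t, ht, htm⟩ := exists_lt_of_lt_csSup ⟨0, h0⟩ (show m - ε < sSup A by linarith)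
    have htm' : t ≤ m := le_csSup hbd ht
    refine ⟨F t, ht.2, ?_⟩
    rw [hF.1 m hmI t ht.1, abs_of_nonneg (by linarith)]
    linarith
  refine ⟨F m, hcl, fun p hp => ?_⟩
  rw [← gromovProduct_eq_zero_iff]
  refine le_antisymm (not_lt.1 fun he => ?_) (gromovProduct_nonneg _ _ _)
  -- If `p` and `x` lay in one direction from `F m`, the point `F (m + e)` would lie between `p` and
  -- `F m`, hence in `S`, contradicting the choice of `m` as a supremum.
  set e := gromovProduct (F m) p x with he'
  have hex : e ≤ dist (F m) x := gromovProduct_le_right _ _ _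
  have hFx := hF.dist_right hmI
  have hr : m + e ∈ Set.Icc 0 (dist a x) := ⟨by linarith [hmI.1], by linarith⟩
  have hd : dist (F m) (F (m + e)) = e := by
    rw [hF.1 m hmI _ hr, abs_sub_comm, abs_of_nonneg (by linarith)]
    ring
  have hb : e ≤ gromovProduct (F m) (F (m + e)) x := by
    have := hF.dist_right hr
    unfold gromovProduct
    linarith
  have hp' : e ≤ gromovProduct (F m) (F (m + e)) p :=
    h.le_gromovProduct_trans hb (by rw [gromovProduct_comm])
  have hbtw : Btw p (F (m + e)) (F m) := by
    have := dist_triangle (F m) (F (m + e)) p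
    unfold gromovProduct at hp'
    unfold Btw
    rw [dist_comm p, dist_comm p, dist_comm (F (m + e)) (F m)]
    linarith
  have hmem : F (m + e) ∈ S := h.mem_of_btw_closure hS hp hcl hbtw fun heq => by
    rw [heq, dist_self] at hd
    exact he.ne hd
  have := le_csSup hbd (show m + e ∈ A from ⟨hr, hmem⟩)
  linarith

end IsGeodesicHyperbolic

/-! ### Directions at a point -/

/-- `l` labels the directions at `p` injectively; if `onto` holds, every label is used. -/
def IsLabelling {X : Type*} [MetricSpace X] {D : Type*} (onto : Prop) (p : X) (l : X → D) : Prop :=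
  (∀ x, x ≠ p → ∀ y, y ≠ p → (l x = l y ↔ 0 < gromovProduct p x y)) ∧
    (onto → ∀ d, ∃ x, x ≠ p ∧ l x = d)

namespace IsLabelling

variable {X : Type*} [MetricSpace X] {D : Type*} {onto : Prop} {p : X} {l : X → D}

theorem comp_perm (hl : IsLabelling onto p l) (σ : Equiv.Perm D) :
    IsLabelling onto p (σ ∘ l) := by
  refine ⟨fun x hx y hy => ?_, fun ho d => ?_⟩
  · rw [← hl.1 x hx y hy]
    exact σ.injective.eq_iff
  · obtain ⟨x, hx, hd⟩ := hl.2 ho (σ.symm d)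
    exact ⟨x, hx, by simp [hd]⟩

theorem exists_apply_eq (hl : IsLabelling onto p l) (x : X) (d : D) :
    ∃ l' : X → D, IsLabelling onto p l' ∧ l' x = d := by
  classical
  exact ⟨_, hl.comp_perm (Equiv.swap (l x) d), Equiv.swap_apply_left _ _⟩

/-- Two transpositions suffice: the second moves neither `d` nor, therefore, the label already fixed
at `x`. -/
theorem exists_apply_eq_apply_eq (hl : IsLabelling onto p l) {x y : X} (hxy : l x ≠ l y)
    {d e : D} (hde : d ≠ e) :
    ∃ l' : X → D, IsLabelling onto p l' ∧ l' x = d ∧ l' y = e := by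
  classical
  set σ := Equiv.swap (l x) d with hσ
  have h1 : σ (l x) = d := Equiv.swap_apply_left _ _
  have h2 : σ (l y) ≠ d := fun h => hxy (σ.injective (h1.trans h.symm))
  refine ⟨_, (hl.comp_perm σ).comp_perm (Equiv.swap (σ (l y)) e), ?_, ?_⟩
  · simp only [Function.comp_apply, h1]
    exact Equiv.swap_apply_of_ne_of_ne h2.symm hde
  · exact Equiv.swap_apply_left _ _

end IsLabelling

/-- A direction is clopen, since the ball of radius `dist p z` about `z` stays in the direction of
`z`. Conversely, a segment between two points in the same direction avoids `p`. -/
theorem IsGeodesicHyperbolic.connectedComponents_eq_iff {X : Type*} [MetricSpace X]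
    (h : IsGeodesicHyperbolic X) {p : X} (x y : ({p}ᶜ : Set X)) :
    (x : ConnectedComponents ({p}ᶜ : Set X)) = y ↔ 0 < gromovProduct p x y := by
  rw [ConnectedComponents.coe_eq_coe']
  constructor
  · intro hx
    set U : Set ({p}ᶜ : Set X) := {z | 0 < gromovProduct p z y} with hU
    have hnear : ∀ z w : ({p}ᶜ : Set X), dist w z < dist p z →
        0 < gromovProduct p (w : X) z := by
      intro z w hwz
      have := le_gromovProduct p (z : X) w
      rw [gromovProduct_comm]
      rw [dist_comm, Subtype.dist_eq] at hwz
      linarith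
    have hpos : ∀ z : ({p}ᶜ : Set X), 0 < dist p z := fun z => dist_pos.2 (Ne.symm z.2)
    have hop : IsOpen U := by
      refine Metric.isOpen_iff.2 fun z hz => ⟨dist p z, hpos z, fun w hw => ?_⟩
      exact h.gromovProduct_pos_trans (hnear z w hw) hz
    have hcl : IsClosed U := by
      rw [← isOpen_compl_iff]
      refine Metric.isOpen_iff.2 fun z hz => ⟨dist p z, hpos z, fun w hw hwU => hz ?_⟩
      refine h.gromovProduct_pos_trans ?_ hwU
      rw [gromovProduct_comm]
      exact hnear z w hw
    have hy : y ∈ U := by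
      change 0 < gromovProduct p (y : X) y
      rw [gromovProduct_self]
      exact hpos y
    exact (IsClopen.connectedComponent_subset ⟨hcl, hop⟩ hy) hx
  · intro hpos
    obtain ⟨F, hF⟩ := h.exists_param (x : X) y
    have hav : ∀ t ∈ Set.Icc 0 (dist (x : X) y), F t ≠ p := by
      rintro t ht rfl
      exact hpos.ne' (gromovProduct_eq_zero_iff.2 (hF.btw ht))
    let G : Set.Icc 0 (dist (x : X) y) → ({p}ᶜ : Set X) := fun t => ⟨F t, hav t t.2⟩
    have hG : Isometry G := Isometry.of_dist_eq fun s t => hF.1 s s.2 t t.2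
    have : PreconnectedSpace (Set.Icc 0 (dist (x : X) y)) :=
      Subtype.preconnectedSpace isPreconnected_Icc
    have hr : IsPreconnected (Set.range G) := isPreconnected_range hG.continuous
    refine hr.subset_connectedComponent
      ⟨⟨_, Set.right_mem_Icc.2 dist_nonneg⟩, Subtype.ext hF.2.2⟩
      ⟨⟨0, Set.left_mem_Icc.2 dist_nonneg⟩, Subtype.ext hF.2.1⟩

theorem IsGeodesicHyperbolic.lift_valency_eq {X : Type v} [MetricSpace X] {D : Type u}
    (h : IsGeodesicHyperbolic X) {p : X} {l : X → D} (hl : IsLabelling True p l) :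
    Cardinal.lift.{u} (valency p) = Cardinal.lift.{v} (Cardinal.mk D) := by
  unfold valency
  rw [Cardinal.lift_mk_eq']
  have hlift : ∀ x y : ({p}ᶜ : Set X), (connectedComponentSetoid _).r x y → l x = l y := by
    intro x y hxy
    have : (x : ConnectedComponents ({p}ᶜ : Set X)) = y := Quotient.sound hxy
    exact (hl.1 x x.2 y y.2).2 ((h.connectedComponents_eq_iff x y).1 this)
  refine ⟨Equiv.ofBijective (Quotient.lift (fun x : ({p}ᶜ : Set X) => l x) hlift) ⟨?_, ?_⟩⟩
  · intro a b
    induction a using Quotient.inductionOn with | _ x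
    induction b using Quotient.inductionOn with | _ y
    intro hxy
    exact (h.connectedComponents_eq_iff x y).2 ((hl.1 x x.2 y y.2).1 hxy)
  · intro d
    obtain ⟨x, hx, hd⟩ := hl.2 trivial d
    exact ⟨Quotient.mk _ ⟨x, hx⟩, hd⟩

theorem IsGeodesicHyperbolic.exists_isLabelling {X : Type v} [MetricSpace X] {D : Type u}
    [Nonempty D] (h : IsGeodesicHyperbolic X) {onto : Prop} {p : X}
    (hle : Cardinal.lift.{u} (valency p) ≤ Cardinal.lift.{v} (Cardinal.mk D))
    (heq : onto → Cardinal.lift.{u} (valency p) = Cardinal.lift.{v} (Cardinal.mk D)) :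
    ∃ l : X → D, IsLabelling onto p l := by
  classical
  obtain ⟨φ, hφ, hφ'⟩ : ∃ φ : ConnectedComponents ({p}ᶜ : Set X) → D, φ.Injective ∧
      (onto → φ.Surjective) := by
    by_cases ho : onto
    · obtain ⟨e⟩ := Cardinal.lift_mk_eq'.1 (heq ho)
      exact ⟨e, e.injective, fun _ => e.surjective⟩
    · obtain ⟨e⟩ := Cardinal.lift_mk_le'.1 hle
      exact ⟨e, e.injective, fun h => absurd h ho⟩
  refine ⟨fun x => if hx : x ≠ p then φ (ConnectedComponents.mk (⟨x, hx⟩ : ({p}ᶜ : Set X)))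
    else Classical.arbitrary D, fun x hx y hy => ?_, fun ho d => ?_⟩
  · simp only [hx, hy, ne_eq, not_false_eq_true, dite_true]
    rw [hφ.eq_iff]
    exact h.connectedComponents_eq_iff (p := p) ⟨x, hx⟩ ⟨y, hy⟩
  · obtain ⟨c, rfl⟩ := hφ' ho d
    obtain ⟨x, rfl⟩ := ConnectedComponents.surjective_coe c
    have hx : (x : X) ≠ p := x.2
    exact ⟨x, hx, by simp only [hx, ne_eq, not_false_eq_true, dite_true]⟩

theorem gromovProduct_congr {X Y : Type*} [MetricSpace X] [MetricSpace Y] {p x y : X}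
    {p' x' y' : Y} (h1 : dist p x = dist p' x') (h2 : dist p y = dist p' y')
    (h3 : dist x y = dist x' y') : gromovProduct p x y = gromovProduct p' x' y' := by
  unfold gromovProduct
  rw [h1, h2, h3]

theorem Btw.eq_of_dist_eq_zero {X : Type*} [MetricSpace X] {x w : X} (h : Btw x w x) : w = x := by
  unfold Btw at h
  rw [dist_self, dist_comm x w] at h
  exact dist_le_zero.1 (by linarith [dist_nonneg (x := w) (y := x)])

theorem IsLabelling.eq_of_btw {X : Type*} [MetricSpace X] {D : Type*} {onto : Prop} {p : X}
    {l : X → D} (hl : IsLabelling onto p l) {w z : X} (hw : Btw p w z) (hwp : w ≠ p) :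
    l w = l z := by
  have hzp : z ≠ p := by
    rintro rfl
    exact hwp hw.eq_of_dist_eq_zero
  rw [hl.1 w hwp z hzp, hw.gromovProduct_eq]
  exact dist_pos.2 hwp.symm

namespace IsGeodesicParam

variable {X : Type*} [MetricSpace X] {F : ℝ → X} {x y : X} (hF : IsGeodesicParam F x y)
include hF

theorem btw_right {s t : ℝ} (hs : 0 ≤ s) (hst : s ≤ t) (ht : t ≤ dist x y) :
    Btw (F s) (F t) y := by
  have e1 := hF.1 s ⟨hs, hst.trans ht⟩ t ⟨hs.trans hst, ht⟩
  rw [abs_sub_comm, abs_of_nonneg (by linarith)] at e1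
  unfold Btw
  rw [hF.dist_right ⟨hs.trans hst, ht⟩, hF.dist_right ⟨hs, hst.trans ht⟩, e1]
  ring

theorem btw_left {s t : ℝ} (hs : 0 ≤ s) (hst : s ≤ t) (ht : t ≤ dist x y) :
    Btw (F t) (F s) x := by
  have e1 := hF.1 s ⟨hs, hst.trans ht⟩ t ⟨hs.trans hst, ht⟩
  rw [abs_sub_comm, abs_of_nonneg (by linarith)] at e1
  unfold Btw
  rw [dist_comm (F s) x, dist_comm (F t) x, hF.dist_left ⟨hs.trans hst, ht⟩,
    hF.dist_left ⟨hs, hst.trans ht⟩, dist_comm, e1]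
  ring

end IsGeodesicParam

/-! ### Partial embeddings and their extension -/

/-- `G` is the graph of an isometry from a convex subset of `T` to `Y`, together with labellings of
the directions at the points of its domain that correspond to the labellings `L`. -/
structure IsPartialEmbedding {T Y D : Type*} [MetricSpace T] [MetricSpace Y] (onto : Prop)
    (L : Y → Y → D) (G : Set (T × Y × (T → D))) : Prop where
  labelling : ∀ a ∈ G, IsLabelling onto a.1 a.2.2
  dist_eq : ∀ a ∈ G, ∀ b ∈ G, dist a.2.1 b.2.1 = dist a.1 b.1
  label_eq : ∀ a ∈ G, ∀ b ∈ G, a.1 ≠ b.1 → L a.2.1 b.2.1 = a.2.2 b.1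
  unique : ∀ a ∈ G, ∀ b ∈ G, a.1 = b.1 → a = b
  convex : IsBtwConvex (Prod.fst '' G)

namespace IsPartialEmbedding

variable {T Y D : Type*} [MetricSpace T] [MetricSpace Y] {onto : Prop}
  {L : Y → Y → D} {G : Set (T × Y × (T → D))}

theorem singleton {p : T} {y : Y} {l : T → D} (hl : IsLabelling onto p l) :
    IsPartialEmbedding onto L {(p, y, l)} where
  labelling := by
    rintro _ rfl
    exact hl
  dist_eq := by
    rintro _ rfl _ rfl
    simp
  label_eq := by
    rintro _ rfl _ rfl h
    exact absurd rfl h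
  unique := by
    rintro _ rfl _ rfl _
    rfl
  convex := by
    rintro _ ⟨_, rfl, rfl⟩ _ ⟨_, rfl, rfl⟩ w hw
    exact ⟨_, rfl, hw.eq_of_dist_eq_zero.symm⟩

theorem sUnion {c : Set (Set (T × Y × (T → D)))} (hc : IsChain (· ⊆ ·) c)
    (h : ∀ G ∈ c, IsPartialEmbedding onto L G) : IsPartialEmbedding onto L (⋃₀ c) := by
  have key : ∀ a ∈ ⋃₀ c, ∀ b ∈ ⋃₀ c, ∃ G ∈ c, a ∈ G ∧ b ∈ G := by
    rintro a ⟨G, hG, ha⟩ b ⟨G', hG', hb⟩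
    rcases hc.total hG hG' with hs | hs
    · exact ⟨G', hG', hs ha, hb⟩
    · exact ⟨G, hG, ha, hs hb⟩
  refine ⟨?_, fun a ha b hb => ?_, fun a ha b hb => ?_, fun a ha b hb => ?_, ?_⟩
  · rintro a ⟨G, hG, ha⟩
    exact (h G hG).labelling a ha
  · obtain ⟨G, hG, ha, hb⟩ := key a ha b hb
    exact (h G hG).dist_eq a ha b hb
  · obtain ⟨G, hG, ha, hb⟩ := key a ha b hb
    exact (h G hG).label_eq a ha b hb
  · obtain ⟨G, hG, ha, hb⟩ := key a ha b hb
    exact (h G hG).unique a ha b hb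
  · rintro _ ⟨a, ha, rfl⟩ _ ⟨b, hb, rfl⟩ w hw
    obtain ⟨G, hG, ha, hb⟩ := key a ha b hb
    obtain ⟨d, hd, rfl⟩ := (h G hG).convex _ ⟨a, ha, rfl⟩ _ ⟨b, hb, rfl⟩ w hw
    exact ⟨d, ⟨G, hG, hd⟩, rfl⟩

/-- Enlarge a partial embedding by points outside its domain. -/
theorem union (hG : IsPartialEmbedding onto L G) {N : Set (T × Y × (T → D))}
    (hlab : ∀ a ∈ N, IsLabelling onto a.1 a.2.2)
    (hdist : ∀ a ∈ N, ∀ b ∈ N, dist a.2.1 b.2.1 = dist a.1 b.1)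
    (hlabel : ∀ a ∈ N, ∀ b ∈ N, a.1 ≠ b.1 → L a.2.1 b.2.1 = a.2.2 b.1)
    (hunique : ∀ a ∈ N, ∀ b ∈ N, a.1 = b.1 → a = b)
    (hdisj : ∀ a ∈ N, ∀ b ∈ G, a.1 ≠ b.1)
    (hdist' : ∀ a ∈ N, ∀ b ∈ G, dist a.2.1 b.2.1 = dist a.1 b.1)
    (hlabel' : ∀ a ∈ N, ∀ b ∈ G, L a.2.1 b.2.1 = a.2.2 b.1)
    (hlabel'' : ∀ a ∈ N, ∀ b ∈ G, L b.2.1 a.2.1 = b.2.2 a.1)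
    (hconv : IsBtwConvex (Prod.fst '' G ∪ Prod.fst '' N)) :
    IsPartialEmbedding onto L (G ∪ N) where
  labelling a ha := ha.elim (hG.labelling a) (hlab a)
  dist_eq := by
    rintro a (ha | ha) b (hb | hb)
    · exact hG.dist_eq a ha b hb
    · rw [dist_comm, hdist' b hb a ha, dist_comm]
    · exact hdist' a ha b hb
    · exact hdist a ha b hb
  label_eq := by
    rintro a (ha | ha) b (hb | hb) hab
    · exact hG.label_eq a ha b hb hab
    · exact hlabel'' b hb a ha
    · exact hlabel' a ha b hb
    · exact hlabel a ha b hb hab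
  unique := by
    rintro a (ha | ha) b (hb | hb) hab
    · exact hG.unique a ha b hb hab
    · exact absurd hab.symm (hdisj b hb a ha)
    · exact absurd hab (hdisj a ha b hb)
    · exact hunique a ha b hb hab
  convex := by rwa [Set.image_union]

theorem extend_closure [CompleteSpace Y] (hT : IsGeodesicHyperbolic T)
    (hL : ∀ y, IsLabelling True y (L y)) (hlab : ∀ p : T, ∃ l : T → D, IsLabelling onto p l)
    (hG : IsPartialEmbedding onto L G) {q : T} (hq : q ∈ closure (Prod.fst '' G))
    (hqG : q ∉ Prod.fst '' G) :
    ∃ G', IsPartialEmbedding onto L G' ∧ G ⊆ G' ∧ q ∈ Prod.fst '' G' := by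
  obtain ⟨u, hu, hlim⟩ := mem_closure_iff_seq_limit.1 hq
  choose a haG hau using hu
  have hcauchy : CauchySeq fun n => (a n).2.1 := by
    rw [Metric.cauchySeq_iff]
    intro ε hε
    obtain ⟨N, hN⟩ := Metric.cauchySeq_iff.1 hlim.cauchySeq ε hε
    refine ⟨N, fun m hm n hn => ?_⟩
    rw [hG.dist_eq _ (haG m) _ (haG n), hau, hau]
    exact hN m hm n hn
  obtain ⟨y, hy⟩ := cauchySeq_tendsto_of_complete hcauchy
  have hd : ∀ b ∈ G, dist y b.2.1 = dist q b.1 := by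
    intro b hb
    refine tendsto_nhds_unique (hy.dist tendsto_const_nhds) ?_
    have : (fun n => dist (a n).2.1 b.2.1) = fun n => dist (u n) b.1 := by
      funext n
      rw [hG.dist_eq _ (haG n) _ hb, hau]
    rw [this]
    exact hlim.dist tendsto_const_nhds
  have hne : ∀ b ∈ G, b.1 ≠ q := fun b hb h => hqG ⟨b, hb, h⟩
  have hne' : ∀ b ∈ G, b.2.1 ≠ y := fun b hb h => by
    have := hd b hb
    rw [h, dist_self] at this
    exact hne b hb (dist_eq_zero.1 this.symm).symm
  obtain ⟨l₀, hl₀⟩ := hlab q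
  -- By convexity the whole domain lies in a single direction at `q`, so aligning the label of one
  -- of its points aligns them all.
  obtain ⟨l, hl, hl1⟩ := hl₀.exists_apply_eq (a 0).1 (L y (a 0).2.1)
  have hconv : ∀ b ∈ G, ∀ w, Btw b.1 w q → w ∈ Prod.fst '' G ∨ w = q := by
    intro b hb w hw
    by_cases hwq : w = q
    · exact Or.inr hwq
    · exact Or.inl (hT.mem_of_btw_closure hG.convex ⟨b, hb, rfl⟩ hq hw hwq)
  refine ⟨G ∪ {(q, y, l)}, hG.union ?_ ?_ ?_ ?_ ?_ ?_ ?_ ?_ ?_, Set.subset_union_left,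
    ⟨_, Or.inr rfl, rfl⟩⟩
  · rintro _ rfl
    exact hl
  · rintro _ rfl _ rfl
    simp
  · rintro _ rfl _ rfl h
    exact absurd rfl h
  · rintro _ rfl _ rfl _
    rfl
  · rintro _ rfl b hb
    exact (hne b hb).symm
  · rintro _ rfl b hb
    exact hd b hb
  · rintro _ rfl b hb
    have hpos : 0 < gromovProduct q b.1 (a 0).1 := by
      refine lt_of_le_of_ne (gromovProduct_nonneg _ _ _) fun h0 => hqG ?_
      exact hG.convex _ ⟨b, hb, rfl⟩ _ ⟨_, haG 0, rfl⟩ q (gromovProduct_eq_zero_iff.1 h0.symm)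
    have hpos' : 0 < gromovProduct y b.2.1 (a 0).2.1 := by
      rwa [gromovProduct_congr (hd b hb) (hd _ (haG 0)) (hG.dist_eq _ hb _ (haG 0))]
    change L y b.2.1 = l b.1
    rw [((hL y).1 _ (hne' b hb) _ (hne' _ (haG 0))).2 hpos', ← hl1]
    exact ((hl.1 _ (hne b hb) _ (hne _ (haG 0))).2 hpos).symm
  · rintro _ rfl b hb
    -- A domain point `c` this close to `q` lies in the direction of `q` from `b`, where the labels
    -- already match.
    obtain ⟨_, ⟨c, hc, rfl⟩, hcq⟩ := Metric.mem_closure_iff.1 hq (dist b.1 q)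
      (dist_pos.2 (hne b hb))
    have hpos : 0 < gromovProduct b.1 q c.1 := by
      have := le_gromovProduct b.1 q c.1
      linarith
    have hcb : c.1 ≠ b.1 := by
      rintro h
      rw [h, dist_comm] at hcq
      exact lt_irrefl _ hcq
    have hcb' : c.2.1 ≠ b.2.1 := by
      intro h
      have := hG.dist_eq c hc b hb
      rw [h, dist_self] at this
      exact hcb (dist_eq_zero.1 this.symm)
    have hpos' : 0 < gromovProduct b.2.1 y c.2.1 := by
      rwa [gromovProduct_congr (by rw [dist_comm, hd b hb, dist_comm]) (hG.dist_eq b hb c hc)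
        (hd c hc)]
    change L b.2.1 y = b.2.2 q
    rw [((hL b.2.1).1 _ (hne' b hb).symm _ hcb').2 hpos', hG.label_eq b hb c hc hcb.symm]
    exact (((hG.labelling b hb).1 _ (hne b hb).symm _ hcb).2 hpos).symm
  · rw [Set.image_singleton]
    rintro _ (⟨b, hb, rfl⟩ | rfl) _ (⟨c, hc, rfl⟩ | rfl) w hw
    · exact Or.inl (hG.convex _ ⟨b, hb, rfl⟩ _ ⟨c, hc, rfl⟩ w hw)
    · exact hconv b hb w hw
    · exact hconv c hc w hw.symm
    · exact Or.inr hw.eq_of_dist_eq_zero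

/-- The gate property makes the direction of `x` at `q` free of domain points. The direction at `y₀`
with the same label is then free of image points, and an initial piece of `[q, x]` is copied into
it. -/
theorem extend_segment (hT : IsGeodesicHyperbolic T) (hY : IsGeodesicHyperbolic Y)
    (hL : ∀ y, IsLabelling True y (L y)) (hlab : ∀ p : T, ∃ l : T → D, IsLabelling onto p l)
    (hG : IsPartialEmbedding onto L G) {a : T × Y × (T → D)} (ha : a ∈ G) {x : T}
    (hx : x ∉ Prod.fst '' G) (hgate : ∀ p ∈ Prod.fst '' G, Btw p a.1 x) :
    ∃ G', IsPartialEmbedding onto L G' ∧ G ⊆ G' ∧ ¬ G' ⊆ G := by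
  obtain ⟨q, y₀, l⟩ := a
  simp only at hgate
  have hxq : x ≠ q := fun h => hx ⟨_, ha, h.symm⟩
  obtain ⟨y, hy, hyl⟩ := (hL y₀).2 trivial (l x)
  obtain ⟨F, hF⟩ := hT.exists_param q x
  obtain ⟨γ, hγ⟩ := hY.exists_param y₀ y
  -- With parameters in the open interval `(0, ε)`, every new point has both a backward and a
  -- forward direction in each tree. These are distinct, so one relabelling matches both.
  obtain ⟨ε, hε, hεx, hεy⟩ : ∃ ε > 0, ε ≤ dist q x ∧ ε ≤ dist y₀ y :=
    ⟨min (dist q x) (dist y₀ y), lt_min (dist_pos.2 hxq.symm) (dist_pos.2 hy.symm),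
      min_le_left _ _, min_le_right _ _⟩
  have hI : ∀ t ∈ Set.Ioo 0 ε, t ∈ Set.Icc 0 (dist q x) := fun t ht =>
    ⟨ht.1.le, ht.2.le.trans hεx⟩
  have hI' : ∀ t ∈ Set.Ioo 0 ε, t ∈ Set.Icc 0 (dist y₀ y) := fun t ht =>
    ⟨ht.1.le, ht.2.le.trans hεy⟩
  have hFq : ∀ t ∈ Set.Ioo 0 ε, F t ≠ q := fun t ht h => by
    have := hF.dist_left (hI t ht)
    rw [h, dist_self] at this
    exact ht.1.ne this
  have hFx : ∀ t ∈ Set.Ioo 0 ε, F t ≠ x := fun t ht h => by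
    have := hF.dist_right (hI t ht)
    rw [h, dist_self] at this
    linarith [ht.2]
  have hγy₀ : ∀ t ∈ Set.Ioo 0 ε, γ t ≠ y₀ := fun t ht h => by
    have := hγ.dist_left (hI' t ht)
    rw [h, dist_self] at this
    exact ht.1.ne this
  have hγy : ∀ t ∈ Set.Ioo 0 ε, γ t ≠ y := fun t ht h => by
    have := hγ.dist_right (hI' t ht)
    rw [h, dist_self] at this
    linarith [ht.2]
  have hex : ∀ t, ∃ m : T → D, t ∈ Set.Ioo 0 ε →
      IsLabelling onto (F t) m ∧ m q = L (γ t) y₀ ∧ m x = L (γ t) y := by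
    intro t
    by_cases ht : t ∈ Set.Ioo 0 ε
    · obtain ⟨m, hm⟩ := hlab (F t)
      have h1 : m q ≠ m x := by
        rw [Ne, hm.1 q (hFq t ht).symm x (hFx t ht).symm]
        exact (gromovProduct_eq_zero_iff.2 (hF.btw (hI t ht))).not_gt
      have h2 : L (γ t) y₀ ≠ L (γ t) y := by
        rw [Ne, (hL (γ t)).1 y₀ (hγy₀ t ht).symm y (hγy t ht).symm]
        exact (gromovProduct_eq_zero_iff.2 (hγ.btw (hI' t ht))).not_gt
      obtain ⟨m', hm'⟩ := hm.exists_apply_eq_apply_eq h1 h2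
      exact ⟨m', fun _ => hm'⟩
    · exact ⟨l, fun h => absurd h ht⟩
  choose m hm using hex
  have hbtw : ∀ b ∈ G, ∀ t ∈ Set.Ioo 0 ε, Btw (F t) q b.1 := fun b hb t ht =>
    (hF.btw (hI t ht)).symm.trans_right (hgate b.1 ⟨b, hb, rfl⟩).symm
  have hne : ∀ b ∈ G, b.1 ≠ q → b.2.1 ≠ y₀ := fun b hb hbq h => by
    have := hG.dist_eq b hb _ ha
    rw [h, dist_self] at this
    exact hbq (dist_eq_zero.1 this.symm)
  -- If `b.2.1` and `y` shared a direction at `y₀`, equal labels would put `b.1` and `x` in one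
  -- direction at `q`, against the gate property.
  have hgate' : ∀ b ∈ G, Btw b.2.1 y₀ y := by
    intro b hb
    by_cases hbq : b.1 = q
    · rw [hG.unique b hb _ ha hbq]
      exact btw_left _ _
    · have h1 : L y₀ b.2.1 = l b.1 := hG.label_eq _ ha b hb (Ne.symm hbq)
      rw [← gromovProduct_eq_zero_iff]
      refine le_antisymm (not_lt.1 fun hpos => ?_) (gromovProduct_nonneg _ _ _)
      have h2 : l b.1 = l x := by
        rw [← h1, ← hyl, (hL y₀).1 _ (hne b hb hbq) _ hy]
        exact hpos
      have h3 : 0 < gromovProduct q b.1 x := ((hG.labelling _ ha).1 _ hbq x hxq).1 h2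
      exact h3.ne' (gromovProduct_eq_zero_iff.2 (hgate b.1 ⟨b, hb, rfl⟩))
  have hbtw' : ∀ b ∈ G, ∀ t ∈ Set.Ioo 0 ε, Btw (γ t) y₀ b.2.1 := fun b hb t ht =>
    (hγ.btw (hI' t ht)).symm.trans_right (hgate' b hb).symm
  have hcore : ∀ t ∈ Set.Ioo 0 ε, ∀ w, Btw q w (F t) →
      w ∈ Prod.fst '' G ∪ Prod.fst '' ((fun t => (F t, γ t, m t)) '' Set.Ioo 0 ε) := by
    intro t ht w hw
    by_cases hwq : w = q
    · exact Or.inl ⟨_, ha, hwq.symm⟩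
    · have hle : dist q w ≤ t := by
        have e1 := hF.dist_left (hI t ht)
        unfold Btw at hw
        linarith [dist_nonneg (x := w) (y := F t)]
      have hr : dist q w ∈ Set.Ioo 0 ε := ⟨dist_pos.2 (Ne.symm hwq), hle.trans_lt ht.2⟩
      refine Or.inr ⟨_, ⟨dist q w, hr, rfl⟩, ?_⟩
      exact hT.eq_of_btw (hF.btw (hI _ hr)) (hw.trans_left (hF.btw (hI t ht)))
        (hF.dist_left (hI _ hr))
  have hFdisj : ∀ t ∈ Set.Ioo 0 ε, ∀ b ∈ G, F t ≠ b.1 := by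
    intro t ht b hb h
    have := hbtw b hb t ht
    rw [h] at this
    exact hFq t ht (h.trans this.eq_of_dist_eq_zero.symm)
  have hFinj : ∀ s ∈ Set.Ioo 0 ε, ∀ t ∈ Set.Ioo 0 ε, F s = F t → s = t := by
    intro s hs t ht h
    rw [← hF.dist_left (hI s hs), ← hF.dist_left (hI t ht), h]
  refine ⟨G ∪ (fun t => (F t, γ t, m t)) '' Set.Ioo 0 ε, hG.union ?_ ?_ ?_ ?_ ?_ ?_ ?_ ?_ ?_,
    Set.subset_union_left, fun hsub => ?_⟩
  · rintro _ ⟨t, ht, rfl⟩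
    exact (hm t ht).1
  · rintro _ ⟨s, hs, rfl⟩ _ ⟨t, ht, rfl⟩
    exact (hγ.1 s (hI' s hs) t (hI' t ht)).trans (hF.1 s (hI s hs) t (hI t ht)).symm
  · rintro _ ⟨s, hs, rfl⟩ _ ⟨t, ht, rfl⟩ hne
    simp only at hne ⊢
    have hγne : γ t ≠ γ s := by
      intro h
      apply hne
      rw [← hγ.dist_left (hI' s hs), ← hγ.dist_left (hI' t ht), h]
    rcases le_total s t with hst | hst
    · rw [(hL (γ s)).eq_of_btw (hγ.btw_right hs.1.le hst (hI' t ht).2) hγne,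
        (hm s hs).1.eq_of_btw (hF.btw_right hs.1.le hst (hI t ht).2) hne.symm, (hm s hs).2.2]
    · rw [(hL (γ s)).eq_of_btw (hγ.btw_left ht.1.le hst (hI' s hs).2) hγne,
        (hm s hs).1.eq_of_btw (hF.btw_left ht.1.le hst (hI s hs).2) hne.symm, (hm s hs).2.1]
  · rintro _ ⟨s, hs, rfl⟩ _ ⟨t, ht, rfl⟩ h
    rw [hFinj s hs t ht h]
  · rintro _ ⟨t, ht, rfl⟩ b hb
    exact hFdisj t ht b hb
  · rintro _ ⟨t, ht, rfl⟩ b hb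
    have e1 := hbtw b hb t ht
    have e2 := hbtw' b hb t ht
    have e3 := hF.dist_left (hI t ht)
    have e4 := hγ.dist_left (hI' t ht)
    have e5 : dist y₀ b.2.1 = dist q b.1 := hG.dist_eq _ ha b hb
    unfold Btw at e1 e2
    rw [dist_comm _ q] at e1
    rw [dist_comm _ y₀] at e2
    simp only
    linarith
  · rintro _ ⟨t, ht, rfl⟩ b hb
    simp only
    rw [← (hL (γ t)).eq_of_btw (hbtw' b hb t ht) (hγy₀ t ht).symm,
      ← (hm t ht).1.eq_of_btw (hbtw b hb t ht) (hFq t ht).symm, (hm t ht).2.1]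
  · rintro _ ⟨t, ht, rfl⟩ b hb
    simp only
    by_cases hbq : b.1 = q
    · rw [hG.unique b hb _ ha hbq]
      simp only
      rw [(hL y₀).eq_of_btw (hγ.btw (hI' t ht)) (hγy₀ t ht), hyl]
      exact ((hG.labelling _ ha).eq_of_btw (hF.btw (hI t ht)) (hFq t ht)).symm
    · rw [← (hL b.2.1).eq_of_btw (hbtw' b hb t ht).symm (hne b hb hbq).symm,
        ← (hG.labelling b hb).eq_of_btw (hbtw b hb t ht).symm (Ne.symm hbq)]
      exact hG.label_eq b hb _ ha hbq
  · have hmixed : ∀ b ∈ G, ∀ t ∈ Set.Ioo 0 ε, ∀ w, Btw b.1 w (F t) →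
        w ∈ Prod.fst '' G ∪ Prod.fst '' ((fun t => (F t, γ t, m t)) '' Set.Ioo 0 ε) := by
      intro b hb t ht w hw
      rcases hT.btw_or_btw (hbtw b hb t ht).symm hw with h1 | h1
      · exact Or.inl (hG.convex _ ⟨b, hb, rfl⟩ _ ⟨_, ha, rfl⟩ w h1)
      · exact hcore t ht w h1
    have hnew : ∀ s ∈ Set.Ioo 0 ε, ∀ t ∈ Set.Ioo 0 ε, s ≤ t → ∀ w, Btw (F t) w (F s) →
        w ∈ Prod.fst '' G ∪ Prod.fst '' ((fun t => (F t, γ t, m t)) '' Set.Ioo 0 ε) := by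
      intro s hs t ht hst w hw
      exact hcore t ht w (hw.trans_left (hF.btw_left hs.1.le hst (hI t ht).2)).symm
    rintro _ (⟨b, hb, rfl⟩ | ⟨_, ⟨s, hs, rfl⟩, rfl⟩) _ (⟨c, hc, rfl⟩ | ⟨_, ⟨t, ht, rfl⟩, rfl⟩) w hw
    · exact Or.inl (hG.convex _ ⟨b, hb, rfl⟩ _ ⟨c, hc, rfl⟩ w hw)
    · exact hmixed b hb t ht w hw
    · exact hmixed c hc s hs w hw.symm
    · rcases le_total s t with hst | hst
      · exact hnew s hs t ht hst w hw.symm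
      · exact hnew t ht s hs hst w hw
  · have ht : ε / 2 ∈ Set.Ioo 0 ε := ⟨by linarith, by linarith⟩
    exact hFdisj _ ht _ (hsub (Or.inr ⟨_, ht, rfl⟩)) rfl

end IsPartialEmbedding

/-- A tree whose directions can be labelled by `D` embeds into every complete tree with directions
labelled by all of `D`, and fills it if it is complete and all its labels are used. -/
theorem IsGeodesicHyperbolic.exists_isometry {T Y D : Type*} [MetricSpace T] [MetricSpace Y]
    [CompleteSpace Y] (hT : IsGeodesicHyperbolic T) (hY : IsGeodesicHyperbolic Y) {onto : Prop}
    {L : Y → Y → D} (hL : ∀ y, IsLabelling True y (L y))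
    (hlab : ∀ p : T, ∃ l : T → D, IsLabelling onto p l) (x₀ : T) (y₀ : Y) :
    ∃ F : T → Y, Isometry F ∧ F x₀ = y₀ ∧ (onto → CompleteSpace T → F.Surjective) := by
  obtain ⟨l₀, hl₀⟩ := hlab x₀
  obtain ⟨G, hsub, hmax⟩ := zorn_subset_nonempty
    {G : Set (T × Y × (T → D)) | IsPartialEmbedding onto L G}
    (fun c hc hchain _ => ⟨⋃₀ c, IsPartialEmbedding.sUnion hchain hc,
      fun s hs => Set.subset_sUnion_of_mem hs⟩)
    {(x₀, y₀, l₀)} (IsPartialEmbedding.singleton hl₀)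
  have hG : IsPartialEmbedding onto L G := hmax.prop
  have h0 : (x₀, y₀, l₀) ∈ G := hsub rfl
  have hdom : ∀ x, ∃ y : Y × (T → D), (x, y) ∈ G := by
    by_contra! hcon
    obtain ⟨x, hx⟩ := hcon
    have hx' : x ∉ Prod.fst '' G := by
      rintro ⟨a, ha, rfl⟩
      exact hx a.2 ha
    obtain ⟨q, hq, hgate⟩ := hT.exists_gate hG.convex ⟨x₀, _, h0, rfl⟩ x
    by_cases hqG : q ∈ Prod.fst '' G
    · obtain ⟨a, ha, rfl⟩ := hqG
      obtain ⟨G', hG', hs, hn⟩ := hG.extend_segment hT hY hL hlab ha hx' hgate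
      exact hn (hmax.le_of_ge hG' hs)
    · obtain ⟨G', hG', hs, a, ha, rfl⟩ := hG.extend_closure hT hL hlab hq hqG
      exact hqG ⟨a, hmax.le_of_ge hG' hs ha, rfl⟩
  choose F hF using hdom
  have hiso : Isometry fun x => (F x).1 :=
    Isometry.of_dist_eq fun x y => hG.dist_eq _ (hF x) _ (hF y)
  refine ⟨fun x => (F x).1, hiso, ?_, fun ho hcomplete => ?_⟩
  · have := hG.unique _ (hF x₀) _ h0 rfl
    exact congrArg (fun a => a.2.1) this
  · have hclosed : IsClosed (Set.range fun x => (F x).1) := hiso.isClosedEmbedding.isClosed_range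
    have hconv : IsBtwConvex (Set.range fun x => (F x).1) := by
      rintro _ ⟨a, rfl⟩ _ ⟨b, rfl⟩ w hw
      have e1 : dist (F a).1 (F b).1 = dist a b := hiso.dist_eq a b
      have hw' : dist (F a).1 w + dist w (F b).1 = dist a b := hw.trans e1
      obtain ⟨z, hz1, hz2⟩ := hT.exists_between a b (dist (F a).1 w) dist_nonneg
        (by linarith [dist_nonneg (x := w) (y := (F b).1)])
      refine ⟨z, hY.eq_of_btw ?_ hw ?_⟩
      · have e2 : dist (F a).1 (F z).1 = dist a z := hiso.dist_eq a z
        have e3 : dist (F z).1 (F b).1 = dist z b := hiso.dist_eq z b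
        unfold Btw
        rw [e1, e2, e3, hz1, hz2]
        ring
      · exact (hiso.dist_eq a z).trans hz1
    -- A missed point `y` has its gate in the closed convex image, say at the image of `q`. The
    -- label of the direction towards `y` is used at `q` by some `x`, whose image lies in that
    -- direction, against the gate property.
    by_contra hsurj
    obtain ⟨y, hy⟩ := not_forall.1 hsurj
    obtain ⟨_, hq, hgate⟩ := hY.exists_gate hconv ⟨_, x₀, rfl⟩ y
    rw [hclosed.closure_eq] at hq
    obtain ⟨q, rfl⟩ := hq
    have hyq : y ≠ (F q).1 := fun h => hy ⟨q, h.symm⟩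
    obtain ⟨x, hxq, hx⟩ := (hG.labelling _ (hF q)).2 ho (L (F q).1 y)
    simp only at hxq hx
    have hxq' : (F x).1 ≠ (F q).1 := fun h => hxq (hiso.injective h)
    have h1 : L (F q).1 (F x).1 = (F q).2 x := hG.label_eq _ (hF q) _ (hF x) (Ne.symm hxq)
    have h2 := ((hL (F q).1).1 _ hxq' _ hyq).1 (h1.trans hx)
    exact h2.ne' (gromovProduct_eq_zero_iff.2 (hgate _ ⟨x, rfl⟩))

/-! ### The function space: geodesics, completeness and directions -/

namespace FunctionTree

variable {C : Type u} [Zero C]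

/-- The value of `f` at `t`, with the value `0` outside the domain. -/
noncomputable def eval (f : FunctionTree C) (t : ℝ) : C :=
  open Classical in if h : t < f.rho then f.toFun ⟨t, h⟩ else 0

theorem eval_of_lt {f : FunctionTree C} {t : ℝ} (h : t < f.rho) : f.eval t = f.toFun ⟨t, h⟩ :=
  dif_pos h

theorem agreeBelow_iff {f g : FunctionTree C} {t : ℝ} :
    AgreeBelow f g t ↔ t ≤ f.rho ∧ t ≤ g.rho ∧ ∀ s < t, f.eval s = g.eval s := by
  constructor
  · rintro ⟨hf, hg, h⟩
    refine ⟨hf, hg, fun s hs => ?_⟩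
    rw [eval_of_lt (hs.trans_le hf), eval_of_lt (hs.trans_le hg)]
    exact h s hs
  · rintro ⟨hf, hg, h⟩
    refine ⟨hf, hg, fun s hs => ?_⟩
    rw [← eval_of_lt (hs.trans_le hf), ← eval_of_lt (hs.trans_le hg)]
    exact h s hs

theorem exists_eval_eq_zero (f : FunctionTree C) : ∃ τ, ∀ t < τ, f.eval t = 0 := by
  obtain ⟨τ, hτ, h⟩ := f.zero_near_bot
  exact ⟨τ, fun t ht => (eval_of_lt (ht.trans_le hτ)).trans (h _ ht)⟩

theorem exists_eval_eq (f : FunctionTree C) {t : ℝ} (ht : t < f.rho) :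
    ∃ ε > 0, t + ε < f.rho ∧ ∀ s ∈ Set.Icc t (t + ε), f.eval s = f.eval t := by
  obtain ⟨ε, hε, hlt, h⟩ := f.const_right ⟨t, ht⟩
  refine ⟨ε, hε, hlt, fun s hs => ?_⟩
  rw [eval_of_lt ht, eval_of_lt (hs.2.trans_lt hlt)]
  exact h _ hs

/-- The element of the function space given by the restriction of a total function. -/
def ofFun (r : ℝ) (F : ℝ → C) (h0 : ∃ τ, ∀ t < τ, F t = 0)
    (h1 : ∀ t < r, ∃ ε > 0, ∀ s ∈ Set.Icc t (t + ε), s < r → F s = F t) : FunctionTree C where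
  rho := r
  toFun t := F t
  zero_near_bot := by
    obtain ⟨τ, hτ⟩ := h0
    exact ⟨min τ r, min_le_right _ _, fun t ht => hτ t (ht.trans_le (min_le_left _ _))⟩
  const_right t := by
    obtain ⟨t, ht⟩ := t
    have ht' : t < r := ht
    obtain ⟨ε, hε, h⟩ := h1 t ht'
    -- Halving `r - t` keeps the interval strictly inside the domain.
    refine ⟨min ε ((r - t) / 2), lt_min hε (by linarith), ?_, fun s hs => h s ⟨hs.1, ?_⟩ s.2⟩
    · have := min_le_right ε ((r - t) / 2)
      simp only
      linarith
    · exact hs.2.trans (by simp)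

theorem eval_ofFun {r : ℝ} {F : ℝ → C} {h0 : ∃ τ, ∀ t < τ, F t = 0}
    {h1 : ∀ t < r, ∃ ε > 0, ∀ s ∈ Set.Icc t (t + ε), s < r → F s = F t} {t : ℝ} (ht : t < r) :
    (ofFun r F h0 h1).eval t = F t :=
  eval_of_lt (f := ofFun r F h0 h1) ht

instance : Nonempty (FunctionTree C) :=
  ⟨ofFun 0 (fun _ => 0) ⟨0, fun _ _ => rfl⟩ fun _ _ => ⟨1, one_pos, fun _ _ _ => rfl⟩⟩

theorem dist_def (f g : FunctionTree C) :
    dist f g = (f.rho - sep f g) + (g.rho - sep f g) := rfl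

theorem exists_restrict (f : FunctionTree C) {t : ℝ} (ht : t ≤ f.rho) :
    ∃ g : FunctionTree C, g.rho = t ∧ sep f g = t := by
  have h1 : ∀ s < t, ∃ ε > 0, ∀ r ∈ Set.Icc s (s + ε), r < t → f.eval r = f.eval s := by
    intro s hs
    obtain ⟨ε, hε, -, h⟩ := f.exists_eval_eq (hs.trans_le ht)
    exact ⟨ε, hε, fun r hr _ => h r hr⟩
  refine ⟨ofFun t f.eval f.exists_eval_eq_zero h1, rfl, le_antisymm (sep_le_right _ _) ?_⟩
  exact le_sep (agreeBelow_iff.2 ⟨ht, le_rfl, fun s hs => (eval_ofFun hs).symm⟩)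

theorem exists_extend (f : FunctionTree C) (c : C) :
    ∃ g : FunctionTree C, f.rho < g.rho ∧ AgreeBelow f g f.rho ∧ g.eval f.rho = c := by
  classical
  let F : ℝ → C := fun t => if t < f.rho then f.eval t else c
  have hF : ∀ t, t < f.rho → F t = f.eval t := fun t ht => if_pos ht
  have hF' : ∀ t, f.rho ≤ t → F t = c := fun t ht => if_neg (not_lt.2 ht)
  have h0 : ∃ τ, ∀ t < τ, F t = 0 := by
    obtain ⟨τ, hτ⟩ := f.exists_eval_eq_zero
    refine ⟨min τ f.rho, fun t ht => ?_⟩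
    rw [hF t (ht.trans_le (min_le_right _ _)), hτ t (ht.trans_le (min_le_left _ _))]
  have h1 : ∀ t < f.rho + 1, ∃ ε > 0, ∀ s ∈ Set.Icc t (t + ε), s < f.rho + 1 → F s = F t := by
    intro t _
    by_cases ht : t < f.rho
    · obtain ⟨ε, hε, hlt, h⟩ := f.exists_eval_eq ht
      refine ⟨ε, hε, fun s hs _ => ?_⟩
      rw [hF s (hs.2.trans_lt hlt), hF t ht, h s hs]
    · push Not at ht
      refine ⟨1, one_pos, fun s hs _ => ?_⟩
      rw [hF' t ht, hF' s (ht.trans hs.1)]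
  have hlt : f.rho < f.rho + 1 := lt_add_one _
  refine ⟨ofFun (f.rho + 1) F h0 h1, hlt, agreeBelow_iff.2 ⟨le_rfl, hlt.le, fun s hs => ?_⟩, ?_⟩
  · rw [eval_ofFun (hs.trans hlt), hF s hs]
  · rw [eval_ofFun hlt, hF' _ le_rfl]

theorem isGeodesicHyperbolic : IsGeodesicHyperbolic (FunctionTree C) where
  exists_between f g r h0 hr := by
    -- The geodesic descends from `f` to height `sep f g` by truncation and then climbs to `g`.
    -- `key` is the descent; exchanging `f` and `g` gives the climb.
    have key : ∀ f g : FunctionTree C, ∀ t, sep f g ≤ t → t ≤ f.rho →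
        ∃ z, dist f z = f.rho - t ∧ dist z g = t + g.rho - 2 * sep f g := by
      intro f g t hs ht
      obtain ⟨z, hz, hfz⟩ := f.exists_restrict ht
      have h1 := min_sep_le z f g
      have h2 := min_sep_le f z g
      have h3 := sep_le_left z g
      rw [sep_comm z f, hfz, min_eq_right hs] at h1
      rw [hfz, min_eq_right (hz ▸ h3)] at h2
      refine ⟨z, ?_, ?_⟩ <;> rw [dist_def]
      · linarith
      · linarith
    rw [dist_def] at hr ⊢
    rcases le_total r (f.rho - sep f g) with hrs | hrs
    · obtain ⟨z, h1, h2⟩ := key f g (f.rho - r) (by linarith) (by linarith)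
      exact ⟨z, by linarith, by linarith⟩
    · obtain ⟨z, h1, h2⟩ := key g f (2 * sep f g - f.rho + r) (by rw [sep_comm]; linarith)
        (by linarith)
      rw [sep_comm g f] at h2
      exact ⟨z, by rw [dist_comm]; linarith, by rw [dist_comm]; linarith⟩
  -- The `rho` terms cancel: `sep x y + sep z w` must be at least the smaller of the other two pair
  -- sums, which follows from the ultrametric inequality for `sep`.
  four_point x y z w := by
    have h1 := min_sep_le x z y
    have h2 := min_sep_le x w y
    have h3 := min_sep_le z x w
    have h4 := min_sep_le z y w
    rw [sep_comm z y] at h1 h4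
    rw [sep_comm w y] at h2
    rw [sep_comm z x] at h3
    rw [le_max_iff]
    simp only [dist_def]
    by_contra! hcon
    obtain ⟨c1, c2⟩ := hcon
    rcases min_le_iff.1 h1 with h1 | h1 <;> rcases min_le_iff.1 h2 with h2 | h2 <;>
      rcases min_le_iff.1 h3 with h3 | h3 <;> rcases min_le_iff.1 h4 with h4 | h4 <;> linarith

theorem abs_rho_sub_le (f g : FunctionTree C) : |f.rho - g.rho| ≤ dist f g := by
  have h1 := sep_le_left f g
  have h2 := sep_le_right f g
  rw [dist_def, abs_le]
  constructor <;> linarith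

instance : CompleteSpace (FunctionTree C) := by
  refine Metric.complete_of_cauchySeq_tendsto fun u hu => ?_
  have hu' := Metric.cauchySeq_iff.1 hu
  have hρ : CauchySeq fun n => (u n).rho := by
    refine Metric.cauchySeq_iff.2 fun ε hε => ?_
    obtain ⟨N, hN⟩ := hu' ε hε
    exact ⟨N, fun m hm n hn => (abs_rho_sub_le _ _).trans_lt (hN m hm n hn)⟩
  obtain ⟨r, hr⟩ := cauchySeq_tendsto_of_complete hρ
  -- Twice the separation is the sum of the two `rho`, each above `(r + t) / 2`, minus a distance
  -- below `r - t`; so it exceeds `2 * t`.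
  have hev : ∀ t < r, ∃ N, ∀ m ≥ N, ∀ n ≥ N, t < sep (u m) (u n) := by
    intro t ht
    obtain ⟨N, hN⟩ := hu' (r - t) (by linarith)
    obtain ⟨M, hM⟩ := Metric.tendsto_atTop.1 hr ((r - t) / 2) (by linarith)
    refine ⟨max N M, fun m hm n hn => ?_⟩
    have h1 := hN m (le_of_max_le_left hm) n (le_of_max_le_left hn)
    have h2 := (abs_lt.1 (hM m (le_of_max_le_right hm))).1
    have h3 := (abs_lt.1 (hM n (le_of_max_le_right hn))).1
    rw [dist_def] at h1
    linarith
  choose! N hN using hev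
  let F : ℝ → C := fun t => (u (N t)).eval t
  have hF : ∀ t < r, ∀ n ≥ N t, ∀ s ≤ t, F s = (u n).eval s := by
    intro t ht n hn s hs
    have hsr := hs.trans_lt ht
    have e1 := (agreeBelow_iff.1 (agreeBelow_sep (u (N s)) (u (max (N s) n)))).2.2 s
      (hN s hsr _ le_rfl _ (le_max_left _ _))
    have e2 := (agreeBelow_iff.1 (agreeBelow_sep (u n) (u (max (N s) n)))).2.2 s
      (hs.trans_lt (hN t ht _ hn _ (hn.le.trans (le_max_right _ _))))
    exact e1.trans e2.symm
  have h0 : ∃ τ, ∀ t < τ, F t = 0 := by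
    obtain ⟨τ, hτ⟩ := (u (N (r - 1))).exists_eval_eq_zero
    refine ⟨min τ (r - 1), fun t ht => ?_⟩
    rw [hF (r - 1) (by linarith) _ le_rfl t (ht.le.trans (min_le_right _ _))]
    exact hτ t (ht.trans_le (min_le_left _ _))
  have h1 : ∀ t < r, ∃ ε > 0, ∀ s ∈ Set.Icc t (t + ε), s < r → F s = F t := by
    intro t ht
    -- Up to `t'` the limit coincides with a single term of the sequence, whose right-constancy at
    -- `t` it inherits.
    obtain ⟨t', htt', ht'⟩ := exists_between ht
    have hlt : t' < (u (N t')).rho :=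
      (hN t' ht' _ le_rfl _ le_rfl).trans_le (sep_le_left _ _)
    obtain ⟨ε, hε, -, h⟩ := (u (N t')).exists_eval_eq (htt'.trans hlt)
    refine ⟨min ε (t' - t), lt_min hε (by linarith), fun s hs _ => ?_⟩
    have h2 : s ≤ t' := by linarith [hs.2, min_le_right ε (t' - t)]
    rw [hF t' ht' _ le_rfl s h2, hF t' ht' _ le_rfl t htt'.le]
    exact h s ⟨hs.1, hs.2.trans (by linarith [min_le_left ε (t' - t)])⟩
  refine ⟨ofFun r F h0 h1, Metric.tendsto_atTop.2 fun ε hε => ?_⟩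
  obtain ⟨M, hM⟩ := Metric.tendsto_atTop.1 hr (ε / 4) (by linarith)
  have ht : r - ε / 4 < r := by linarith
  refine ⟨max M (N (r - ε / 4)), fun n hn => ?_⟩
  have e1 := (abs_lt.1 (hM n (le_of_max_le_left hn))).2
  have e2 : r - ε / 4 ≤ sep (u n) (ofFun r F h0 h1) := by
    have hn' := le_of_max_le_right hn
    refine le_sep (agreeBelow_iff.2 ⟨?_, ht.le, fun s hs => ?_⟩)
    · exact (hN _ ht n hn' n hn').le.trans (sep_le_left _ _)
    · rw [eval_ofFun (hs.trans ht)]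
      exact (hF _ ht n hn' s hs.le).symm
  have e3 : (ofFun r F h0 h1).rho = r := rfl
  rw [dist_def, e3]
  linarith

/-- The direction from `f` to `g`: the next value of `g` if `g` extends `f`, and `none` if not. -/
noncomputable def direction (f g : FunctionTree C) : Option C :=
  open Classical in if AgreeBelow f g f.rho then some (g.eval f.rho) else none

theorem gromovProduct_eq_sep (f g k : FunctionTree C) :
    gromovProduct f g k = f.rho - sep f g - sep f k + sep g k := by
  unfold gromovProduct
  simp only [dist_def]
  ring

theorem rho_lt_of_agreeBelow {f g : FunctionTree C} (h : AgreeBelow f g f.rho) (hne : g ≠ f) :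
    f.rho < g.rho :=
  lt_of_le_of_ne h.2.1 fun heq => hne (eq_of_agreeBelow h rfl heq.symm).symm

/-- Points not extending `f` all begin by descending along `f`, so they share one direction. Two
proper extensions share a direction exactly when their next values agree, because right-constancy
prolongs that agreement to an interval. -/
theorem isLabelling_direction (f : FunctionTree C) : IsLabelling True f (direction f) := by
  have hagree : ∀ g, AgreeBelow f g f.rho → sep f g = f.rho := fun g hg =>
    le_antisymm (sep_le_left f g) (le_sep hg)
  have hnot : ∀ g, ¬ AgreeBelow f g f.rho → sep f g < f.rho := fun g hg =>
    lt_of_le_of_ne (sep_le_left f g) fun h => hg (h ▸ agreeBelow_sep f g)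
  have hmixed : ∀ g k, AgreeBelow f g f.rho → ¬ AgreeBelow f k f.rho →
      gromovProduct f g k = 0 := by
    intro g k hg hk
    have h1 := hagree g hg
    have h2 := hnot k hk
    have h3 := min_sep_le f g k
    have h4 := min_sep_le g f k
    rw [sep_comm g f, h1, min_eq_right h2.le] at h4
    rw [h1] at h3
    have h5 : sep g k ≤ sep f k := (min_le_iff.1 h3).resolve_left (not_le.2 h2)
    rw [gromovProduct_eq_sep, h1]
    linarith
  refine ⟨fun g hgf k hkf => ?_, fun _ d => ?_⟩
  · unfold direction
    by_cases hg : AgreeBelow f g f.rho <;> by_cases hk : AgreeBelow f k f.rho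
    · rw [if_pos hg, if_pos hk, Option.some_inj, gromovProduct_eq_sep, hagree g hg, hagree k hk]
      constructor
      · intro h
        obtain ⟨ε, hε, hlt, h1⟩ := g.exists_eval_eq (rho_lt_of_agreeBelow hg hgf)
        obtain ⟨δ, hδ, hlt', h2⟩ := k.exists_eval_eq (rho_lt_of_agreeBelow hk hkf)
        have e1 := min_le_left ε δ
        have e2 := min_le_right ε δ
        have e3 : 0 < min ε δ := lt_min hε hδ
        have : f.rho + min ε δ ≤ sep g k := by
          refine le_sep (agreeBelow_iff.2 ⟨by linarith, by linarith, fun s hs => ?_⟩)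
          rcases lt_or_ge s f.rho with hsf | hsf
          · exact ((agreeBelow_iff.1 hg).2.2 s hsf).symm.trans ((agreeBelow_iff.1 hk).2.2 s hsf)
          · rw [h1 s ⟨hsf, by linarith⟩, h2 s ⟨hsf, by linarith⟩, h]
        linarith
      · intro h
        exact (agreeBelow_iff.1 (agreeBelow_sep g k)).2.2 _ (by linarith)
    · rw [if_pos hg, if_neg hk, hmixed g k hg hk]
      simp
    · rw [if_neg hg, if_pos hk, gromovProduct_comm, hmixed k g hk hg]
      simp
    · rw [if_neg hg, if_neg hk, gromovProduct_eq_sep]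
      have h1 := hnot g hg
      have h2 := hnot k hk
      have h3 := min_sep_le g f k
      rw [sep_comm g f] at h3
      refine ⟨fun _ => ?_, fun _ => rfl⟩
      rcases min_le_iff.1 h3 with h3 | h3 <;> linarith
  · cases d with
    | none =>
      obtain ⟨g, hg, hs⟩ := f.exists_restrict (t := f.rho - 1) (by linarith)
      refine ⟨g, ?_, if_neg fun h => ?_⟩
      · rintro rfl
        linarith
      · have := h.2.1
        linarith
    | some c =>
      obtain ⟨g, hlt, hg, hc⟩ := f.exists_extend c
      refine ⟨g, ?_, (if_pos hg).trans (by rw [hc])⟩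
      rintro rfl
      exact lt_irrefl _ hlt

end FunctionTree

/-- The extra element is the downward direction, which accounts for `μ - 1` in the finite case and
changes nothing in the infinite one. -/
theorem IsValueSet.mk_option {μ : Cardinal.{u}} {C : Type u} (hC : IsValueSet μ C) :
    Cardinal.mk (Option C) = μ := by
  rw [Cardinal.mk_option]
  rcases finite_or_infinite C with h | h
  · exact hC.2 h
  · rw [Cardinal.add_one_eq (Cardinal.aleph0_le_mk C)]
    exact hC.1 h

end UniversalTree

theorem theorem1 (μ : Cardinal.{u}) (hμ : 2 ≤ μ) (C : Type u) [Zero C]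
    (hC : UniversalTree.IsValueSet μ C) :
    -- the function space is a complete real tree with valency `μ` at every point
    (CompleteSpace (UniversalTree.FunctionTree C) ∧
      UniversalTree.IsRealTree (UniversalTree.FunctionTree C) ∧
      ∀ f : UniversalTree.FunctionTree C, UniversalTree.valency f = μ) ∧
    -- (i) universality
    UniversalTree.IsUniversalRealTree.{u, v} μ (UniversalTree.FunctionTree C) ∧
    -- (ii) uniqueness
    (∀ (T : Type v) [MetricSpace T] [Nonempty T] [CompleteSpace T],
      UniversalTree.IsRealTree T →
      (∀ t : T, Cardinal.lift.{u} (UniversalTree.valency t) = Cardinal.lift.{v} μ) →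
      Nonempty (T ≃ᵢ UniversalTree.FunctionTree C)) ∧
    -- (iii) homogeneity
    UniversalTree.IsHomogeneous (UniversalTree.FunctionTree C) := by
  have hA := UniversalTree.FunctionTree.isGeodesicHyperbolic (C := C)
  have hL := UniversalTree.FunctionTree.isLabelling_direction (C := C)
  have hμC := hC.mk_option
  refine ⟨⟨inferInstance, hA.isRealTree, fun f => ?_⟩, ⟨hA.isRealTree, ?_⟩, ?_, ?_⟩
  · rw [← hμC]
    simpa using hA.lift_valency_eq (hL f)
  · intro T _ hT hval
    rcases isEmpty_or_nonempty T with hempty | ⟨⟨x⟩⟩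
    · exact ⟨fun x => hempty.elim x, fun x => hempty.elim x⟩
    · have hT' := hT.isGeodesicHyperbolic
      -- With valency at most `μ` the labels need only be injective, so `onto` is `False`.
      obtain ⟨F, hF, -⟩ := hT'.exists_isometry hA hL (fun p =>
        hT'.exists_isLabelling (onto := False) (hμC ▸ hval p) False.elim) x
        (Classical.arbitrary _)
      exact ⟨F, hF⟩
  · intro T _ hne _ hT hval
    have hT' := hT.isGeodesicHyperbolic
    obtain ⟨F, hF, -, hsurj⟩ := hT'.exists_isometry hA hL (fun p =>
      hT'.exists_isLabelling (onto := True) (hμC ▸ (hval p).le) fun _ => hμC ▸ hval p)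
      (Classical.choice hne) (Classical.arbitrary _)
    exact ⟨⟨Equiv.ofBijective F ⟨hF.injective, hsurj trivial inferInstance⟩, hF⟩⟩
  · intro f g
    -- Homogeneity is the extension theorem from the function space to itself, with base points `f`
    -- and `g`.
    obtain ⟨F, hF, hfg, hsurj⟩ := hA.exists_isometry hA hL (fun p => ⟨_, hL p⟩) f g
    exact ⟨⟨Equiv.ofBijective F ⟨hF.injective, hsurj trivial inferInstance⟩, hF⟩, hfg⟩
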